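/- For a finite set $S$ of points in the plane let $\mathrm{per}(S)$ be the perimeter of its convex hull (twice the length of the hull if the hull is a segment, $0$ for a single point). A bipartition of a point set $P$ is a pair $(P_1,P_2)$ of disjoint non-empty sets with union $P$; the minimum perimeter-sum problem asks for a bipartition minimizing $\mathrm{per}(P_1)+\mathrm{per}(P_2)$. The model of computation is the real RAM with unit-cost arithmetic, square roots, comparisons, floor, indirect addressing, and the operation on two real numbers in $[0,1)$ that returns the side length of the smallest canonical dyadic interval containing both. Suppose we have an exact algorithm $A$ for the minimum perimeter-sum problem whose running time on every instance with $k\ge 2$ points is at most $T(k)$. Then there is an algorithm $B$ which, given any $\varepsilon>0$ and any set $P$ of $n\ge 2$ points in the plane, computes a bipartition $(P_1,P_2)$ of $P$ such that $$\mathrm{per}(P_1)+\mathrm{per}(P_2)\le(1+\varepsilon)\cdot\bigl(\mathrm{per}(P_1^*)+\mathrm{per}(P_2^*)\bigr)$$ for every bipartition $(P_1^*,P_2^*)$ of $P$ that minimizes $\mathrm{per}(P_1^*)+\mathrm{per}(P_2^*)$, in $O(n+T(1/\varepsilon^2))$ time. Precisely: (1) the running time of $B$ is at most $C\cdot\bigl(n+\max_{2\le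 k\le C/\varepsilon^2}T(k)\bigr)$ for an absolute constant $C>0$ (an empty maximum is $0$); (2) if $T$ is non-decreasing and $T(2k)\le D\cdot T(k)$ for all $k\ge1$, then the running time of $B$ is at most $K_D\cdot\bigl(n+T(\lceil 1/\varepsilon^2\rceil)\bigr)$, where $K_D$ depends only on $D$; (3) if $T(k)\le a\,k\log^4k$ for all $k\ge2$, then the running time of $B$ is at most $L_a\cdot\bigl(n+\varepsilon^{-2}\log^4(1/\varepsilon)\bigr)$, where $L_a$ depends only on $a$. -/

import Mathlib

noncomputable section

namespace PerimeterSum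

/-! ### Perimeter of the convex hull of a finite planar point set -/

/-- The Euclidean plane. -/
abbrev Plane : Type := EuclideanSpace ℝ (Fin 2)

/-- Orientation of the triple `(p, q, s)`: positive iff `s` lies strictly to the left of the
directed line from `p` to `q`. -/
def orient (p q s : Plane) : ℝ :=
  (q 0 - p 0) * (s 1 - p 1) - (q 1 - p 1) * (s 0 - p 0)

/-- `(p, q)` is an edge, in counterclockwise direction, of the boundary polygon of the convex hull
of `S`: every point of `S` lies strictly to the left of the directed line from `p` to `q` or on
the segment `pq`. If `S` has at least two points and is collinear, its hull is a segment and both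
directed versions of this segment are edges (the boundary is traversed as a closed curve). -/
def IsHullEdge (S : Finset Plane) (p q : Plane) : Prop :=
  p ∈ S ∧ q ∈ S ∧ p ≠ q ∧ ∀ s ∈ S, 0 < orient p q s ∨ s ∈ segment ℝ p q

open Classical in
/-- The perimeter of the convex hull of `S`: the total length of the edges of its boundary
polygon. It is `0` for a single point, and twice the length if the hull is a segment. -/
def per (S : Finset Plane) : ℝ :=
  ∑ p ∈ S, ∑ q ∈ S, if IsHullEdge S p q then dist p q else 0

/-! ### Bipartitions

A point set of size `n` is given as an injective family `p : Fin n → Plane`; a split of it into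
two parts is a labelling `c : Fin n → Bool`. -/

open Classical in
/-- The part of the point set whose points have label `b`. -/
def part {n : ℕ} (p : Fin n → Plane) (c : Fin n → Bool) (b : Bool) : Finset Plane :=
  (Finset.univ.filter fun i => c i = b).image p

/-- Both parts are non-empty. -/
def IsBipartition {n : ℕ} (c : Fin n → Bool) : Prop :=
  ∀ b : Bool, ∃ i, c i = b

/-- The sum of the perimeters of the convex hulls of the two parts. -/
def cost {n : ℕ} (p : Fin n → Plane) (c : Fin n → Bool) : ℝ :=
  per (part p c true) + per (part p c false)

/-- A bipartition that minimizes the perimeter sum. -/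
def IsOptimal {n : ℕ} (p : Fin n → Plane) (c : Fin n → Bool) : Prop :=
  IsBipartition c ∧ ∀ c' : Fin n → Bool, IsBipartition c' → cost p c ≤ cost p c'

/-! ### The real RAM

The machine has registers, which are addressed directly, and a memory, which is addressed
indirectly; every register and every memory cell holds a real number. In unit time the machine
performs one arithmetic operation, square root, floor, comparison with a jump, memory access, or the
operation on dyadic intervals which yields the smallest canonical square of a quadtree that contains
two given points. -/

/-- The side length of the smallest canonical dyadic interval `[j / 2 ^ i, (j + 1) / 2 ^ i)`, with
`i : ℕ`, that contains both `a` and `b` (and `0` if there is no smallest one). -/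
def dyadicSide (a b : ℝ) : ℝ :=
  sInf {s : ℝ | ∃ i : ℕ, s = (1 / 2) ^ i ∧ ⌊a / s⌋ = ⌊b / s⌋}

/-- Instructions; `d` is the target register, `a` and `b` are source registers. -/
inductive Instr : Type
  | const (d : ℕ) (z : ℤ)
  | move (d a : ℕ)
  | add (d a b : ℕ)
  | sub (d a b : ℕ)
  | mul (d a b : ℕ)
  | div (d a b : ℕ)
  | sqrt (d a : ℕ)
  | floor (d a : ℕ)
  | dyadic (d a b : ℕ)
  /-- Copy the memory cell whose address is in register `a` to register `d`. -/
  | load (d a : ℕ)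
  /-- Copy register `a` to the memory cell whose address is in register `d`. -/
  | store (d a : ℕ)
  /-- Jump to instruction `l` if the content of `a` is at most the content of `b`. -/
  | jumpLe (a b l : ℕ)

/-- A program is a finite list of instructions. -/
abbrev Program : Type := List Instr

/-- A configuration: program counter, registers and memory. -/
structure Config : Type where
  pc : ℕ
  reg : ℕ → ℝ
  mem : ℕ → ℝ

/-- Write `x` to register `d` and go on with the next instruction. -/
def Config.write (s : Config) (d : ℕ) (x : ℝ) : Config :=
  ⟨s.pc + 1, Function.update s.reg d x, s.mem⟩

open Classical in
/-- The effect of one instruction. The address given by a real number `x` is `⌊x⌋₊`. -/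
def Instr.exec (s : Config) : Instr → Config
  | .const d z => s.write d (z : ℝ)
  | .move d a => s.write d (s.reg a)
  | .add d a b => s.write d (s.reg a + s.reg b)
  | .sub d a b => s.write d (s.reg a - s.reg b)
  | .mul d a b => s.write d (s.reg a * s.reg b)
  | .div d a b => s.write d (s.reg a / s.reg b)
  | .sqrt d a => s.write d (Real.sqrt (s.reg a))
  | .floor d a => s.write d (⌊s.reg a⌋ : ℝ)
  | .dyadic d a b => s.write d (dyadicSide (s.reg a) (s.reg b))
  | .load d a => s.write d (s.mem ⌊s.reg a⌋₊)
  | .store d a => ⟨s.pc + 1, s.reg, Function.update s.mem ⌊s.reg d⌋₊ (s.reg a)⟩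
  | .jumpLe a b l => if s.reg a ≤ s.reg b then ⟨l, s.reg, s.mem⟩ else ⟨s.pc + 1, s.reg, s.mem⟩

/-- One step of the machine. The machine has halted, and does not change any more, once the program
counter is outside the program. -/
def step (Q : Program) (s : Config) : Config :=
  match Q[s.pc]? with
  | some i => i.exec s
  | none => s

/-- The initial configuration: the input is in the memory cells `0, 1, 2, …`; all other cells and
all registers contain `0`. -/
def start (l : List ℝ) : Config := ⟨0, fun _ => 0, fun i => l.getD i 0⟩

/-- Started on the input `l`, the program `Q` halts after at most `t` steps, with memory `m`. -/
def HaltsWithin (Q : Program) (l : List ℝ) (t : ℕ) (m : ℕ → ℝ) : Prop :=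
  Q.length ≤ ((step Q)^[t] (start l)).pc ∧ ((step Q)^[t] (start l)).mem = m

/-- The list of coordinates `x₀, y₀, x₁, y₁, …` of the points. -/
def coords {n : ℕ} (p : Fin n → Plane) : List ℝ :=
  (List.ofFn fun i => [p i 0, p i 1]).flatten

/-- The memory contains the labelling `c` in the cells `0, …, n - 1`, as zeros and ones. -/
def Outputs {n : ℕ} (m : ℕ → ℝ) (c : Fin n → Bool) : Prop :=
  ∀ i : Fin n, m i = if c i = true then 1 else 0

/-! ### Algorithms for the minimum perimeter-sum problem -/

/-- `A` is an exact algorithm for the minimum perimeter-sum problem with running time `T`: for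
every set of `k ≥ 2` points it outputs an optimal bipartition after at most `T k` steps. The input
consists of `k` and the coordinates of the points. -/
def IsExactAlgorithm (A : Program) (T : ℕ → ℕ) : Prop :=
  ∀ (k : ℕ) (p : Fin k → Plane), 2 ≤ k → Function.Injective p →
    ∃ (m : ℕ → ℝ) (c : Fin k → Bool),
      HaltsWithin A ((k : ℝ) :: coords p) (T k) m ∧ Outputs m c ∧ IsOptimal p c

/-- `B` is an approximation scheme for the minimum perimeter-sum problem with running time at most
`bound n ε`: for every set of `n ≥ 2` points and every `ε > 0` it outputs a bipartition whose
perimeter sum is at most `1 + ε` times the optimal one. The input consists of `n`, `ε` and the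
coordinates of the points. -/
def IsApproximationScheme (B : Program) (bound : ℕ → ℝ → ℝ) : Prop :=
  ∀ (n : ℕ) (p : Fin n → Plane) (ε : ℝ), 2 ≤ n → Function.Injective p → 0 < ε →
    ∃ (t : ℕ) (m : ℕ → ℝ) (c : Fin n → Bool),
      (t : ℝ) ≤ bound n ε ∧
      HaltsWithin B ((n : ℝ) :: ε :: coords p) t m ∧ Outputs m c ∧ IsBipartition c ∧
      ∀ cOpt : Fin n → Bool, IsOptimal p cOpt → cost p c ≤ (1 + ε) * cost p cOpt

/-- The largest value of `T` on instance sizes `2, …, N` (`0` if `N < 2`); it is `T N` if `T` is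
monotone and `2 ≤ N`. -/
def maxTime (T : ℕ → ℕ) (N : ℕ) : ℕ := (Finset.Icc 2 N).sup T

end PerimeterSum

end

noncomputable section

namespace PerimeterSum

/-! Two facts about perimeters carry the geometry. If every point of S is within δ of S', then per S
≤ per S' + 2πδ (`per_le_add`); and two points of S at distance d force per S ≥ 2d
(`two_mul_dist_le_per`). Both follow from the Cauchy–Crofton formula `two_mul_per`: twice the
perimeter is the integral of the width over all directions. Since `per` is a sum over hull edges,
the width must first be recovered from edges. By `climb_eq_width` the upward edges in a direction
project onto disjoint intervals that fill the height range, because almost every level is crossed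
upward by exactly one edge.

The scheme takes the first point z, a farthest point q from it, and R = |zq|. If every point is
within R/16 of z or of q, these two clusters are an optimal bipartition (`cost_le_of_clustered`).
Otherwise some third point is at least R/16 from both; two of the three points share a label, so
every labelling costs at least R/8 (`le_cost_of_spread`). If in addition ε ≥ 128, any bipartition is
good enough, as none costs more than 4πR. For ε < 128 one point is kept from each non-empty cell of
a grid with cells of side R/N, N ≈ 256/ε. The exact algorithm solves this instance of O(1/ε²)
points, and every point inherits the label of its representative. Passing to representatives does
not raise the optimum (`IsOptimal.cost_le_of_comp`), and going back costs at most 4π·2R/N, which is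
at most ε times the optimum (`IsOptimal.cost_comp_le`).

The rest implements this on the machine. `Block.Runs` is a Hoare triple with a time bound for
relocatable code. `runs_embedded` simulates the exact algorithm on shifted registers and memory at
six steps per instruction. The grid table is never cleared, because unused memory is zero from the
start, so the work outside the exact algorithm is linear in n. -/

/-! ### Heights in a direction and hull edges -/

/-- The height of a point in direction `(a, b)`. -/
def height (a b : ℝ) (s : Plane) : ℝ := a * s 0 + b * s 1

/-- The coordinate of a point perpendicular to the direction `(a, b)`. -/
def lateral (a b : ℝ) (s : Plane) : ℝ := b * s 0 - a * s 1

/-- The coordinates (height, lateral) arise from the standard ones by a reflection, of determinant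
-(a² + b²) = -1; hence the order of the two products. -/
lemma orient_eq_height {a b : ℝ} (h : a ^ 2 + b ^ 2 = 1) (p q s : Plane) :
    orient p q s = (lateral a b q - lateral a b p) * (height a b s - height a b p)
      - (height a b q - height a b p) * (lateral a b s - lateral a b p) := by
  unfold orient lateral height
  linear_combination
    (-((q 0 - p 0) * (s 1 - p 1) - (q 1 - p 1) * (s 0 - p 0))) * h

lemma plane_ext {s s' : Plane} (h0 : s 0 = s' 0) (h1 : s 1 = s' 1) : s = s' := by
  ext i; fin_cases i
  · exact h0
  · exact h1

lemma mem_segment_of_orient_eq_zero {a b : ℝ} (h : a ^ 2 + b ^ 2 = 1) {p q s : Plane}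
    (ho : orient p q s = 0) (hpq : height a b p < height a b q)
    (h1 : height a b p ≤ height a b s) (h2 : height a b s ≤ height a b q) :
    s ∈ segment ℝ p q := by
  rw [orient_eq_height h] at ho
  have hd : 0 < height a b q - height a b p := by linarith
  obtain ⟨l, hl⟩ : ∃ l, l = (height a b s - height a b p) / (height a b q - height a b p) :=
    ⟨_, rfl⟩
  have hf : height a b s = height a b p + l * (height a b q - height a b p) := by
    rw [hl]; field_simp; ring
  have hg : lateral a b s = lateral a b p + l * (lateral a b q - lateral a b p) := by
    rw [hl]; field_simp; linarith
  refine ⟨1 - l, l, ?_, ?_, by ring, ?_⟩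
  · rw [hl, sub_nonneg, div_le_one hd]; linarith
  · rw [hl]; exact div_nonneg (by linarith) hd.le
  · apply plane_ext
    · simp only [PiLp.add_apply, PiLp.smul_apply, smul_eq_mul]
      unfold height at hf; unfold lateral at hg
      linear_combination (-a) * hf - b * hg + (s 0 - p 0 - l * (q 0 - p 0)) * h
    · simp only [PiLp.add_apply, PiLp.smul_apply, smul_eq_mul]
      unfold height at hf; unfold lateral at hg
      linear_combination (-b) * hf + a * hg + (s 1 - p 1 - l * (q 1 - p 1)) * h

lemma height_mem_segment {a b : ℝ} {p q s : Plane} (hs : s ∈ segment ℝ p q) :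
    ∃ l : ℝ, 0 ≤ l ∧ l ≤ 1 ∧ s = p + l • (q - p) ∧
      height a b s = height a b p + l * (height a b q - height a b p) := by
  obtain ⟨x, y, hx, hy, hxy, rfl⟩ := hs
  refine ⟨y, hy, by linarith, ?_, ?_⟩
  · rw [show x = 1 - y by linarith]; module
  · simp only [height, PiLp.add_apply, PiLp.smul_apply, smul_eq_mul]
    rw [show x = 1 - y by linarith]; ring

/-- The lateral coordinate of the point at height `t` of the line through `p` and `q`. -/
def crossing (a b t : ℝ) (p q : Plane) : ℝ :=
  lateral a b p + (lateral a b q - lateral a b p) * (t - height a b p)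
    / (height a b q - height a b p)

/-- If s is strictly to the right of the line from p to q, exchanging q for s moves the crossing at
a level above p to the right. So a rightmost crossing certifies that no such s exists. -/
lemma crossing_sub_left {a b t : ℝ} (h : a ^ 2 + b ^ 2 = 1) {p q s : Plane}
    (hq : height a b p < height a b q) (hs : height a b p < height a b s) :
    crossing a b t p s - crossing a b t p q = (t - height a b p) * (-orient p q s)
      / ((height a b s - height a b p) * (height a b q - height a b p)) := by
  have h1 : height a b q - height a b p ≠ 0 := by linarith [sub_pos.2 hq]
  have h2 : height a b s - height a b p ≠ 0 := by linarith [sub_pos.2 hs]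
  rw [orient_eq_height h, crossing, crossing]
  field_simp
  ring

lemma crossing_sub_right {a b t : ℝ} (h : a ^ 2 + b ^ 2 = 1) {p q s : Plane}
    (hq : height a b p < height a b q) (hs : height a b s < height a b q) :
    crossing a b t s q - crossing a b t p q = (height a b q - t) * (-orient p q s)
      / ((height a b q - height a b s) * (height a b q - height a b p)) := by
  have h1 : height a b q - height a b p ≠ 0 := by linarith [sub_pos.2 hq]
  have h2 : height a b q - height a b s ≠ 0 := by linarith [sub_pos.2 hs]
  rw [orient_eq_height h, crossing, crossing]
  field_simp
  ring

/-- Among all segments from below the level to above it, take one with rightmost crossing and, among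
those, one with the largest rise. A point strictly to its right would give a crossing further right;
a collinear point beyond an end would give a larger rise. -/
lemma exists_hullEdge_crossing {a b t : ℝ} (h : a ^ 2 + b ^ 2 = 1) {S : Finset Plane}
    (hB : ∃ s ∈ S, height a b s ≤ t) (hA : ∃ s ∈ S, t < height a b s)
    (ht : ∀ s ∈ S, height a b s ≠ t) :
    ∃ p q, IsHullEdge S p q ∧ height a b p < t ∧ t < height a b q := by
  classical
  obtain ⟨p₁, hp₁, hp₁'⟩ := hB
  obtain ⟨q₁, hq₁, hq₁'⟩ := hA
  let U := (S ×ˢ S).filter fun e => height a b e.1 < t ∧ t < height a b e.2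
  have hU : U.Nonempty := ⟨(p₁, q₁), by
    simp only [U, Finset.mem_filter, Finset.mem_product]
    exact ⟨⟨hp₁, hq₁⟩, lt_of_le_of_ne hp₁' (ht _ hp₁), hq₁'⟩⟩
  obtain ⟨e₀, he₀, hmax₀⟩ := U.exists_max_image (fun e => crossing a b t e.1 e.2) hU
  let V := U.filter fun e => crossing a b t e.1 e.2 = crossing a b t e₀.1 e₀.2
  obtain ⟨⟨p, q⟩, he, hmax⟩ := V.exists_max_image
    (fun e => height a b e.2 - height a b e.1) ⟨e₀, by simp [V, he₀]⟩
  simp only [V, U, Finset.mem_filter, Finset.mem_product] at he hmax₀ hmax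
  obtain ⟨⟨⟨hp, hq⟩, hpt, hqt⟩, hX⟩ := he
  have hpq : height a b p < height a b q := hpt.trans hqt
  refine ⟨p, q, ⟨hp, hq, ?_, ?_⟩, hpt, hqt⟩
  · rintro rfl; exact lt_irrefl _ hpq
  intro s hs
  by_contra hcon
  push Not at hcon
  obtain ⟨ho, hseg⟩ := hcon
  rcases lt_or_gt_of_ne (ht s hs) with hst | hst
  · have h1 := hmax₀ (s, q) ⟨⟨hs, hq⟩, hst, hqt⟩
    have h2 := crossing_sub_right (t := t) h hpq (hst.trans hqt)
    rcases ho.lt_or_eq with ho | ho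
    · have : 0 < crossing a b t s q - crossing a b t p q := by
        rw [h2]
        apply div_pos (mul_pos _ _) (mul_pos _ _) <;> linarith
      simp only at h1
      linarith
    · rw [ho] at h2
      have h3 := hmax (s, q) ⟨⟨⟨hs, hq⟩, hst, hqt⟩, by
        simp only [neg_zero, mul_zero, zero_div] at h2; simp only; linarith⟩
      simp only at h3
      exact hseg (mem_segment_of_orient_eq_zero h ho hpq (by linarith) (by linarith))
  · have h1 := hmax₀ (p, s) ⟨⟨hp, hs⟩, hpt, hst⟩
    have h2 := crossing_sub_left (t := t) h hpq (hpt.trans hst)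
    rcases ho.lt_or_eq with ho | ho
    · have : 0 < crossing a b t p s - crossing a b t p q := by
        rw [h2]
        apply div_pos (mul_pos _ _) (mul_pos _ _) <;> linarith
      simp only at h1
      linarith
    · rw [ho] at h2
      have h3 := hmax (p, s) ⟨⟨⟨hp, hs⟩, hpt, hst⟩, by
        simp only [neg_zero, mul_zero, zero_div] at h2; simp only; linarith⟩
      simp only at h3
      exact hseg (mem_segment_of_orient_eq_zero h ho hpq (by linarith) (by linarith))

lemma orient_eq_zero_of_mem_segment {p q s : Plane} (hs : s ∈ segment ℝ p q) :
    orient p q s = 0 := by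
  obtain ⟨x, y, -, -, hxy, rfl⟩ := hs
  simp only [orient, PiLp.add_apply, PiLp.smul_apply, smul_eq_mul]
  rw [show x = 1 - y by linarith]; ring

lemma IsHullEdge.orient_nonneg {S : Finset Plane} {p q s : Plane} (h : IsHullEdge S p q)
    (hs : s ∈ S) : 0 ≤ orient p q s := by
  rcases h.2.2.2 s hs with h1 | h1
  · exact h1.le
  · exact (orient_eq_zero_of_mem_segment h1).ge

/-- The weighted orientation of the end points of `p' q'` is the signed distance of the two
crossing points, up to positive factors. -/
lemma orient_combination {a b t : ℝ} (h : a ^ 2 + b ^ 2 = 1) {p q p' q' : Plane}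
    (hpq : height a b p < height a b q) (hpq' : height a b p' < height a b q') :
    (height a b q' - t) * orient p q p' + (t - height a b p') * orient p q q'
      = (height a b q - height a b p) * (height a b q' - height a b p')
        * (crossing a b t p q - crossing a b t p' q') := by
  have h1 : height a b q - height a b p ≠ 0 := by linarith [sub_pos.2 hpq]
  have h2 : height a b q' - height a b p' ≠ 0 := by linarith [sub_pos.2 hpq']
  rw [orient_eq_height h, orient_eq_height h, crossing, crossing]
  field_simp
  ring

/-- `orient_combination`, applied both ways round, has opposite right-hand sides, while all four
weighted orientations are non-negative. Hence all vanish, the four end points are collinear, and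
each segment contains the other. -/
lemma hullEdge_crossing_unique {a b t : ℝ} (h : a ^ 2 + b ^ 2 = 1) {S : Finset Plane}
    {p q p' q' : Plane} (he : IsHullEdge S p q) (he' : IsHullEdge S p' q')
    (hp : height a b p < t) (hq : t < height a b q)
    (hp' : height a b p' < t) (hq' : t < height a b q') : p = p' ∧ q = q' := by
  have hpq := hp.trans hq
  have hpq' := hp'.trans hq'
  have e1 := orient_combination (t := t) h hpq hpq'
  have e2 := orient_combination (t := t) h hpq' hpq
  have o1 := he.orient_nonneg he'.1
  have o2 := he.orient_nonneg he'.2.1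
  have o3 := he'.orient_nonneg he.1
  have o4 := he'.orient_nonneg he.2.1
  have n1 := mul_nonneg (sub_nonneg.2 hq'.le) o1
  have n2 := mul_nonneg (sub_nonneg.2 hp'.le) o2
  have n3 := mul_nonneg (sub_nonneg.2 hq.le) o3
  have n4 := mul_nonneg (sub_nonneg.2 hp.le) o4
  have s0 : (height a b q' - height a b p') * (height a b q - height a b p)
        * (crossing a b t p' q' - crossing a b t p q)
      = -((height a b q - height a b p) * (height a b q' - height a b p')
        * (crossing a b t p q - crossing a b t p' q')) := by ring
  have z1 : (height a b q' - t) * orient p q p' = 0 := by linarith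
  have z2 : (t - height a b p') * orient p q q' = 0 := by linarith
  have z3 : (height a b q - t) * orient p' q' p = 0 := by linarith
  have z4 : (t - height a b p) * orient p' q' q = 0 := by linarith
  have w1 := (mul_eq_zero.1 z1).resolve_left (by linarith [sub_pos.2 hq'])
  have w2 := (mul_eq_zero.1 z2).resolve_left (by linarith [sub_pos.2 hp'])
  have w3 := (mul_eq_zero.1 z3).resolve_left (by linarith [sub_pos.2 hq])
  have w4 := (mul_eq_zero.1 z4).resolve_left (by linarith [sub_pos.2 hp])
  have m1 := (he.2.2.2 p' he'.1).resolve_left (by linarith)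
  have m2 := (he.2.2.2 q' he'.2.1).resolve_left (by linarith)
  have m3 := (he'.2.2.2 p he.1).resolve_left (by linarith)
  have m4 := (he'.2.2.2 q he.2.1).resolve_left (by linarith)
  obtain ⟨l1, h1, h1', e1, f1⟩ := height_mem_segment (a := a) (b := b) m1
  obtain ⟨l2, h2, h2', e2, f2⟩ := height_mem_segment (a := a) (b := b) m2
  obtain ⟨l3, h3, h3', -, f3⟩ := height_mem_segment (a := a) (b := b) m3
  obtain ⟨l4, h4, h4', -, f4⟩ := height_mem_segment (a := a) (b := b) m4
  have d : 0 < height a b q - height a b p := by linarith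
  have d' : 0 < height a b q' - height a b p' := by linarith
  have k1 : l1 = 0 := by
    by_contra hne
    have := mul_pos (lt_of_le_of_ne h1 (Ne.symm hne)) d
    have := mul_nonneg h3 d'.le
    linarith
  have k2 : l2 = 1 := by
    by_contra hne
    have := mul_pos (sub_pos.2 (lt_of_le_of_ne h2' hne)) d
    have := mul_nonneg (sub_nonneg.2 h4') d'.le
    linarith
  subst k1 k2
  exact ⟨by simp [e1], by simp [e2]⟩

/-! ### The perimeter as an integral of widths -/

open Classical in
/-- The total rise of the upward edges of the hull in direction `(a, b)`. -/
def climb (S : Finset Plane) (a b : ℝ) : ℝ :=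
  ∑ p ∈ S, ∑ q ∈ S, if IsHullEdge S p q then max (height a b q - height a b p) 0 else 0

/-- Raising the level slightly avoids the heights of all points without passing any. This reduces
half-open height intervals to strict crossings. -/
lemma exists_separating_level {S : Finset Plane} (a b t : ℝ) (hA : ∃ s ∈ S, t < height a b s) :
    ∃ t', t < t' ∧ ∀ s ∈ S, t < height a b s → t' < height a b s := by
  classical
  obtain ⟨s, hs, hst⟩ := hA
  obtain ⟨q, hq, hmin⟩ := (S.filter fun s => t < height a b s).exists_min_image (height a b)
    ⟨s, by simp [hs, hst]⟩
  simp only [Finset.mem_filter] at hq hmin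
  exact ⟨(t + height a b q) / 2, by linarith [hq.2], fun r hr hrt => by
    linarith [hmin r ⟨hr, hrt⟩, hq.2]⟩

/-- The half-open height intervals of the upward edges partition the range from the minimal to the
maximal height: existence and uniqueness of the crossing edge give covering and disjointness.
Comparing lengths gives the claim; other edges have empty intervals, matching the `max` with 0. -/
lemma climb_eq_width {a b : ℝ} (h : a ^ 2 + b ^ 2 = 1) {S : Finset Plane} (hS : S.Nonempty) :
    ∃ p ∈ S, ∃ q ∈ S, climb S a b = height a b q - height a b p ∧
      ∀ s ∈ S, height a b p ≤ height a b s ∧ height a b s ≤ height a b q := by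
  classical
  obtain ⟨p, hp, hmin⟩ := S.exists_min_image (height a b) hS
  obtain ⟨q, hq, hmax⟩ := S.exists_max_image (height a b) hS
  refine ⟨p, hp, q, hq, ?_, fun s hs => ⟨hmin s hs, hmax s hs⟩⟩
  let E := (S ×ˢ S).filter fun e => IsHullEdge S e.1 e.2
  let I : Plane × Plane → Set ℝ := fun e => Set.Ico (height a b e.1) (height a b e.2)
  have hunion : ⋃ e ∈ E, I e = Set.Ico (height a b p) (height a b q) := by
    ext t
    simp only [Set.mem_iUnion, exists_prop, E, I, Finset.mem_filter, Finset.mem_product,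
      Set.mem_Ico]
    constructor
    · rintro ⟨e, ⟨⟨h1, h2⟩, -⟩, h3, h4⟩
      exact ⟨(hmin _ h1).trans h3, h4.trans_le (hmax _ h2)⟩
    · rintro ⟨h1, h2⟩
      obtain ⟨t', ht', hsep⟩ := exists_separating_level (S := S) a b t ⟨q, hq, h2⟩
      obtain ⟨p', q', he, hp', hq'⟩ := exists_hullEdge_crossing (t := t') h
        ⟨p, hp, (h1.trans ht'.le)⟩ ⟨q, hq, hsep q hq h2⟩ (fun s hs => by
          rcases le_or_gt (height a b s) t with h5 | h5
          · exact (h5.trans_lt ht').ne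
          · exact (hsep s hs h5).ne')
      refine ⟨(p', q'), ⟨⟨he.1, he.2.1⟩, he⟩, ?_, ht'.trans hq'⟩
      by_contra hcon
      exact absurd (hsep p' he.1 (not_le.1 hcon)) (not_lt.2 hp'.le)
  have hdisj : Set.PairwiseDisjoint (↑E) I := by
    intro e he e' he' hne
    simp only [E, Finset.coe_filter, Set.mem_ofPred_eq, Finset.mem_product] at he he'
    refine Set.disjoint_left.2 fun t h1 h2 => hne ?_
    obtain ⟨t', ht', hsep⟩ := exists_separating_level (S := S) a b t ⟨e.2, he.1.2, h1.2⟩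
    obtain ⟨h3, h4⟩ := hullEdge_crossing_unique (t := t') h he.2 he'.2
      (lt_of_le_of_lt h1.1 ht') (hsep _ he.1.2 h1.2) (lt_of_le_of_lt h2.1 ht')
      (hsep _ he'.1.2 h2.2)
    exact Prod.ext h3 h4
  have hvol := MeasureTheory.measure_biUnion_finset (μ := MeasureTheory.volume) hdisj
    (fun e _ => measurableSet_Ico)
  rw [hunion] at hvol
  simp only [I, Real.volume_Ico] at hvol
  have hreal := congrArg ENNReal.toReal hvol
  rw [ENNReal.toReal_sum (fun _ _ => ENNReal.ofReal_ne_top),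
    ENNReal.toReal_ofReal (by linarith [hmin q hq])] at hreal
  simp only [ENNReal.toReal_ofReal'] at hreal
  rw [hreal, climb, Finset.sum_filter, Finset.sum_product]

lemma climb_empty (a b : ℝ) : climb ∅ a b = 0 := by simp [climb]

lemma height_dist_le {a b : ℝ} (h : a ^ 2 + b ^ 2 = 1) (s t : Plane) :
    |height a b s - height a b t| ≤ dist s t := by
  rw [EuclideanSpace.dist_eq, Fin.sum_univ_two]
  apply Real.abs_le_sqrt
  rw [Real.dist_eq, Real.dist_eq, sq_abs, sq_abs]
  unfold height
  have e : (s 0 - t 0) ^ 2 + (s 1 - t 1) ^ 2 - (a * s 0 + b * s 1 - (a * t 0 + b * t 1)) ^ 2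
      = (b * (s 0 - t 0) - a * (s 1 - t 1)) ^ 2 := by
    linear_combination (-((s 0 - t 0) ^ 2 + (s 1 - t 1) ^ 2)) * h
  linarith [sq_nonneg (b * (s 0 - t 0) - a * (s 1 - t 1))]

lemma climb_le_add {a b δ : ℝ} (h : a ^ 2 + b ^ 2 = 1) (hδ : 0 ≤ δ) {S S' : Finset Plane}
    (hS : ∀ s ∈ S, ∃ s' ∈ S', dist s s' ≤ δ) : climb S a b ≤ climb S' a b + 2 * δ := by
  rcases S.eq_empty_or_nonempty with rfl | hne
  · rw [climb_empty]
    have : 0 ≤ climb S' a b := Finset.sum_nonneg fun p _ => Finset.sum_nonneg fun q _ => by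
      split_ifs
      · exact le_max_right _ _
      · exact le_rfl
    linarith
  obtain ⟨p, hp, q, hq, e, -⟩ := climb_eq_width h hne
  obtain ⟨p', hp', hpp'⟩ := hS p hp
  obtain ⟨q', hq', hqq'⟩ := hS q hq
  obtain ⟨p₁, -, q₁, -, e', h'⟩ := climb_eq_width h ⟨p', hp'⟩
  have h1 := abs_le.1 (height_dist_le h p p')
  have h2 := abs_le.1 (height_dist_le h q q')
  have h3 := h' p' hp'
  have h4 := h' q' hq'
  rw [e, e']
  linarith [h1.1, h2.2, h3.1, h4.2]

lemma abs_height_sub_le_climb {a b : ℝ} (h : a ^ 2 + b ^ 2 = 1) {S : Finset Plane} {s t : Plane}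
    (hs : s ∈ S) (ht : t ∈ S) : |height a b s - height a b t| ≤ climb S a b := by
  obtain ⟨p, -, q, -, e, h'⟩ := climb_eq_width h ⟨s, hs⟩
  rw [e, abs_le]
  constructor <;> linarith [h' s hs, h' t ht]

/-! ### Averages of height differences over all directions -/

open Real in
lemma integral_abs_cos_period (x : ℝ) : ∫ θ in x..(x + 2 * π), |cos θ| = 4 := by
  have hper : Function.Periodic (fun θ => |cos θ|) (2 * π) := fun θ => by simp
  have hint : ∀ u v : ℝ, IntervalIntegrable (fun θ => |cos θ|) MeasureTheory.volume u v :=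
    fun u v =>
    (continuous_cos.abs).intervalIntegrable u v
  rw [hper.intervalIntegral_add_eq x (-(π / 2)),
    ← intervalIntegral.integral_add_adjacent_intervals (hint _ (π / 2)) (hint _ _)]
  have hpi := pi_pos
  have h1 : ∫ θ in (-(π / 2))..(π / 2), |cos θ| = 2 := by
    rw [intervalIntegral.integral_congr (g := cos)]
    · rw [integral_cos]; simp; norm_num
    · intro θ hθ
      rw [Set.uIcc_of_le (by linarith)] at hθ
      exact abs_of_nonneg (cos_nonneg_of_mem_Icc hθ)
  have h2 : ∫ θ in (π / 2)..(-(π / 2) + 2 * π), |cos θ| = 2 := by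
    rw [intervalIntegral.integral_congr (g := fun θ => - cos θ)]
    · rw [intervalIntegral.integral_neg, integral_cos, sin_add_two_pi, sin_neg, sin_pi_div_two]
      norm_num
    · intro θ hθ
      rw [Set.uIcc_of_le (by linarith)] at hθ
      exact abs_of_nonpos (cos_nonpos_of_pi_div_two_le_of_le hθ.1 (by linarith [hθ.2]))
  rw [h1, h2]; norm_num

lemma exists_polar (x y : ℝ) : ∃ φ : ℝ, x = √(x ^ 2 + y ^ 2) * Real.cos φ ∧
    y = √(x ^ 2 + y ^ 2) * Real.sin φ := by
  refine ⟨(⟨x, y⟩ : ℂ).arg, ?_, ?_⟩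
  · have := Complex.norm_mul_cos_arg ⟨x, y⟩
    rw [Complex.norm_def, Complex.normSq_mk, ← sq, ← sq] at this
    exact this.symm
  · have := Complex.norm_mul_sin_arg ⟨x, y⟩
    rw [Complex.norm_def, Complex.normSq_mk, ← sq, ← sq] at this
    exact this.symm

-- With s - t in polar form, the height difference in direction θ is |s - t| cos(θ - φ).
open Real in
lemma integral_abs_height (s t : Plane) :
    ∫ θ in (0 : ℝ)..(2 * π), |height (cos θ) (sin θ) s - height (cos θ) (sin θ) t|
      = 4 * dist s t := by
  obtain ⟨φ, h1, h2⟩ := exists_polar (s 0 - t 0) (s 1 - t 1)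
  have hd : dist s t = √((s 0 - t 0) ^ 2 + (s 1 - t 1) ^ 2) := by
    rw [EuclideanSpace.dist_eq, Fin.sum_univ_two, dist_eq, dist_eq, sq_abs, sq_abs]
  rw [← hd] at h1 h2
  have : ∀ θ : ℝ, |height (cos θ) (sin θ) s - height (cos θ) (sin θ) t|
      = dist s t * |cos (θ - φ)| := fun θ => by
    nth_rw 1 [← abs_of_nonneg (dist_nonneg (x := s) (y := t))]
    rw [← abs_mul, cos_sub]
    congr 1
    unfold height
    linear_combination cos θ * h1 + sin θ * h2
  simp_rw [this]
  rw [intervalIntegral.integral_const_mul,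
    intervalIntegral.integral_comp_sub_right (fun θ => |cos θ|) φ,
    show 2 * π - φ = 0 - φ + 2 * π by ring, integral_abs_cos_period]
  ring

lemma continuous_height (s : Plane) :
    Continuous fun θ : ℝ => height (Real.cos θ) (Real.sin θ) s := by
  unfold height; fun_prop

-- The positive part of x is (x + |x|)/2, and the linear term averages to zero over a full turn.
open Real in
lemma integral_max_height (s t : Plane) :
    ∫ θ in (0 : ℝ)..(2 * π), max (height (cos θ) (sin θ) s - height (cos θ) (sin θ) t) 0
      = 2 * dist s t := by
  have hc : Continuous fun θ : ℝ => height (cos θ) (sin θ) s - height (cos θ) (sin θ) t :=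
    (continuous_height s).sub (continuous_height t)
  have h0 : ∫ θ in (0 : ℝ)..(2 * π), (height (cos θ) (sin θ) s - height (cos θ) (sin θ) t)
      = 0 := by
    have : ∀ θ : ℝ, height (cos θ) (sin θ) s - height (cos θ) (sin θ) t
        = (s 0 - t 0) * cos θ + (s 1 - t 1) * sin θ := fun θ => by unfold height; ring
    simp_rw [this]
    rw [intervalIntegral.integral_add, intervalIntegral.integral_const_mul,
      intervalIntegral.integral_const_mul, integral_cos, integral_sin]
    · simp
    · exact (by fun_prop : Continuous _).intervalIntegrable _ _
    · exact (by fun_prop : Continuous _).intervalIntegrable _ _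
  have : ∀ x : ℝ, max x 0 = (1 / 2) * (x + |x|) := fun x => by
    rcases le_total x 0 with h | h
    · rw [max_eq_right h, abs_of_nonpos h]; ring
    · rw [max_eq_left h, abs_of_nonneg h]; ring
  simp_rw [this]
  rw [intervalIntegral.integral_const_mul, intervalIntegral.integral_add
    (hc.intervalIntegrable _ _) (hc.abs.intervalIntegrable _ _), h0, integral_abs_height]
  ring

lemma continuous_climb (S : Finset Plane) :
    Continuous fun θ : ℝ => climb S (Real.cos θ) (Real.sin θ) := by
  unfold climb
  refine continuous_finsetSum _ fun p _ => continuous_finsetSum _ fun q _ => ?_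
  split_ifs
  · exact ((continuous_height q).sub (continuous_height p)).max continuous_const
  · exact continuous_const

/-- The Cauchy–Crofton formula. -/
lemma two_mul_per (S : Finset Plane) :
    2 * per S = ∫ θ in (0 : ℝ)..(2 * Real.pi), climb S (Real.cos θ) (Real.sin θ) := by
  classical
  have hc : ∀ p q : Plane, Continuous fun θ : ℝ => if IsHullEdge S p q then
      max (height (Real.cos θ) (Real.sin θ) q - height (Real.cos θ) (Real.sin θ) p) 0 else 0 :=
    fun p q => by
      split_ifs
      · exact ((continuous_height q).sub (continuous_height p)).max continuous_const
      · exact continuous_const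
  unfold climb per
  rw [intervalIntegral.integral_finsetSum fun p _ =>
    (continuous_finsetSum _ fun q _ => hc p q).intervalIntegrable _ _, Finset.mul_sum]
  refine Finset.sum_congr rfl fun p _ => ?_
  rw [intervalIntegral.integral_finsetSum fun q _ => (hc p q).intervalIntegrable _ _,
    Finset.mul_sum]
  refine Finset.sum_congr rfl fun q _ => ?_
  split_ifs
  · rw [integral_max_height, dist_comm]
  · simp

/-! ### Monotonicity, stability and lower bounds for the perimeter -/

/-- In each direction both extreme points of S move by at most δ, so the width grows by at most 2δ;
integrate over 2π and halve. -/
lemma per_le_add {S S' : Finset Plane} {δ : ℝ} (hδ : 0 ≤ δ)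
    (hS : ∀ s ∈ S, ∃ s' ∈ S', dist s s' ≤ δ) : per S ≤ per S' + 2 * Real.pi * δ := by
  have h := intervalIntegral.integral_mono_on (μ := MeasureTheory.volume) (a := 0)
    (b := 2 * Real.pi)
    (by positivity) ((continuous_climb S).intervalIntegrable _ _)
    (((continuous_climb S').add continuous_const).intervalIntegrable _ _)
    (fun θ _ => climb_le_add (Real.cos_sq_add_sin_sq θ) hδ hS)
  simp only [Pi.add_apply] at h
  rw [intervalIntegral.integral_add ((continuous_climb S').intervalIntegrable _ _)
    (continuous_const.intervalIntegrable _ _), ← two_mul_per, ← two_mul_per,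
    intervalIntegral.integral_const, smul_eq_mul] at h
  linarith

lemma per_mono {S S' : Finset Plane} (h : S ⊆ S') : per S ≤ per S' := by
  have := per_le_add (S := S) (S' := S') le_rfl fun s hs => ⟨s, h hs, (dist_self s).le⟩
  simpa using this

lemma per_nonneg (S : Finset Plane) : 0 ≤ per S := by
  classical
  exact Finset.sum_nonneg fun p _ => Finset.sum_nonneg fun q _ => by
    split_ifs
    · exact dist_nonneg
    · exact le_rfl

lemma per_singleton (p : Plane) : per {p} = 0 := by
  classical
  simp [per, IsHullEdge]

lemma two_mul_dist_le_per {S : Finset Plane} {s t : Plane} (hs : s ∈ S) (ht : t ∈ S) :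
    2 * dist s t ≤ per S := by
  have h := intervalIntegral.integral_mono_on (μ := MeasureTheory.volume) (a := 0)
    (b := 2 * Real.pi)
    (by positivity)
    ((((continuous_height s).sub (continuous_height t)).abs).intervalIntegrable _ _)
    ((continuous_climb S).intervalIntegrable _ _)
    (fun θ _ => abs_height_sub_le_climb (Real.cos_sq_add_sin_sq θ) hs ht)
  simp only [Pi.sub_apply] at h
  rw [integral_abs_height, ← two_mul_per] at h
  linarith

lemma per_le_of_dist_le {S : Finset Plane} {c : Plane} {r : ℝ} (hr : 0 ≤ r)
    (hS : ∀ s ∈ S, dist s c ≤ r) : per S ≤ 2 * Real.pi * r := by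
  have := per_le_add (S := S) (S' := {c}) hr fun s hs => ⟨c, by simp, hS s hs⟩
  simpa [per_singleton] using this

/-! ### Bipartitions of clustered, spread and rounded point sets -/

section Bipartitions

variable {n : ℕ} {p : Fin n → Plane}

lemma mem_part {c : Fin n → Bool} {b : Bool} {s : Plane} :
    s ∈ part p c b ↔ ∃ i, c i = b ∧ p i = s := by
  simp [part]

lemma cost_eq_add_not (c : Fin n → Bool) (b : Bool) :
    cost p c = per (part p c b) + per (part p c (!b)) := by
  cases b
  · exact add_comm _ _
  · rfl

lemma per_part_le_cost (c : Fin n → Bool) (b : Bool) : per (part p c b) ≤ cost p c := by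
  rw [cost_eq_add_not c b]
  linarith [per_nonneg (part p c (!b))]

lemma two_mul_dist_le_cost {c : Fin n → Bool} {i j : Fin n} (h : c i = c j) :
    2 * dist (p i) (p j) ≤ cost p c :=
  (two_mul_dist_le_per (mem_part.2 ⟨i, rfl, rfl⟩) (mem_part.2 ⟨j, h.symm, rfl⟩)).trans
    (per_part_le_cost c (c i))

lemma cost_comp_not (c : Fin n → Bool) : cost p (fun i => !c i) = cost p c := by
  have h : ∀ b, part p (fun i => !c i) b = part p c (!b) := fun b => by
    ext s; simp only [mem_part]
    exact exists_congr fun i => by cases c i <;> cases b <;> simp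
  rw [cost, h, h, cost, add_comm]; rfl

/-- If the points lie in two small discs that are far apart, then the discs induce an optimal
bipartition. -/
lemma cost_le_of_clustered {i₀ j₀ : Fin n} {c c' : Fin n → Bool} {R : ℝ}
    (hR : dist (p i₀) (p j₀) = R)
    (h1 : ∀ i, c i = true → dist (p i) (p i₀) ≤ R / 16)
    (h2 : ∀ i, c i = false → dist (p i) (p j₀) ≤ R / 16)
    (hi : c i₀ = true) (hj : c j₀ = false) : cost p c ≤ cost p c' := by
  have hR0 : 0 ≤ R := hR ▸ dist_nonneg
  have hpi := Real.pi_lt_four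
  -- Two discs of radius R/16 contribute at most 2 · 2π · R/16 = πR/4 < R.
  have hc : cost p c ≤ R := by
    have e1 : per (part p c true) ≤ 2 * Real.pi * (R / 16) :=
      per_le_of_dist_le (c := p i₀) (by positivity) fun s hs => by
        obtain ⟨i, hi, rfl⟩ := mem_part.1 hs; exact h1 i hi
    have e2 : per (part p c false) ≤ 2 * Real.pi * (R / 16) :=
      per_le_of_dist_le (c := p j₀) (by positivity) fun s hs => by
        obtain ⟨i, hi, rfl⟩ := mem_part.1 hs; exact h2 i hi
    unfold cost
    nlinarith
  -- If c' joins points from different discs, their distance is at least R - 2R/16, so c' costs at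
  -- least 7R/4. Otherwise c' is c up to exchanging the labels.
  by_cases h : ∃ i j, c i = true ∧ c j = false ∧ c' i = c' j
  · obtain ⟨i, j, hci, hcj, hij⟩ := h
    have e1 := h1 i hci
    have e2 := h2 j hcj
    have e3 := dist_triangle4 (p i₀) (p i) (p j) (p j₀)
    rw [dist_comm (p i₀) (p i)] at e3
    have := two_mul_dist_le_cost (p := p) hij
    linarith
  · push Not at h
    have ht : ∀ i, c' i = (c i ^^ (!c' i₀)) := fun i => by
      cases hci : c i
      · have := h i₀ i hi hci
        revert this; cases c' i₀ <;> cases c' i <;> simp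
      · have e1 := h i j₀ hci hj
        have e2 := h i₀ j₀ hi hj
        revert e1 e2; cases c' i₀ <;> cases c' i <;> cases c' j₀ <;> simp
    cases h0 : c' i₀
    · rw [h0] at ht
      rw [show c' = fun i => !c i from funext fun i => by rw [ht i]; simp, cost_comp_not]
    · rw [h0] at ht
      rw [show c' = c from funext fun i => by rw [ht i]; simp]

/-- Three points at pairwise distances of at least R/16 receive only two labels. -/
lemma le_cost_of_spread {i₀ j₀ i : Fin n} {c : Fin n → Bool} {R : ℝ}
    (hR : dist (p i₀) (p j₀) = R) (h1 : R / 16 ≤ dist (p i) (p i₀))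
    (h2 : R / 16 ≤ dist (p i) (p j₀)) : R / 8 ≤ cost p c := by
  have hR0 : 0 ≤ R := hR ▸ dist_nonneg
  have : c i = c i₀ ∨ c i = c j₀ ∨ c i₀ = c j₀ := by
    cases c i <;> cases c i₀ <;> cases c j₀ <;> simp
  rcases this with h | h | h <;> have := two_mul_dist_le_cost (p := p) h <;> linarith

lemma cost_le_of_dist_le {c : Fin n → Bool} {z : Plane} {R : ℝ} (hR : 0 ≤ R)
    (h : ∀ i, dist (p i) z ≤ R) : cost p c ≤ 4 * Real.pi * R := by
  have (b : Bool) : per (part p c b) ≤ 2 * Real.pi * R :=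
    per_le_of_dist_le hR fun s hs => by
      obtain ⟨i, -, rfl⟩ := mem_part.1 hs; exact h i
  have h1 := this true
  have h2 := this false
  unfold cost
  linarith

/-- Restricting a bipartition to a subset does not lead to costs below the optimum of the
subset. -/
lemma IsOptimal.cost_le_of_comp {k : ℕ} (hk : 2 ≤ k) {f : Fin k → Fin n} {c : Fin k → Bool}
    (hc : IsOptimal (p ∘ f) c) (c' : Fin n → Bool) : cost (p ∘ f) c ≤ cost p c' := by
  by_cases hb : IsBipartition (c' ∘ f)
  · refine (hc.2 _ hb).trans ?_
    have (b : Bool) : per (part (p ∘ f) (c' ∘ f) b) ≤ per (part p c' b) :=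
      per_mono fun s hs => by
        obtain ⟨i, hi, rfl⟩ := mem_part.1 hs
        exact mem_part.2 ⟨f i, hi, rfl⟩
    exact add_le_add (this _) (this _)
  -- If all representatives have one label under c', splitting off a single representative is a
  -- bipartition that costs no more: the singleton has perimeter 0.
  · unfold IsBipartition at hb
    push Not at hb
    obtain ⟨b, hb⟩ := hb
    have hb' : ∀ i, c' (f i) = !b := fun i => by
      have := hb i; revert this; simp only [Function.comp]; cases c' (f i) <;> cases b <;> simp
    let i₀ : Fin k := ⟨0, by omega⟩
    let i₁ : Fin k := ⟨1, by omega⟩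
    have hne : i₁ ≠ i₀ := by simp [i₀, i₁]
    have hbip : IsBipartition fun i : Fin k => if i = i₀ then b else !b := fun d => by
      by_cases hd : d = b
      · exact ⟨i₀, by simp [hd]⟩
      · exact ⟨i₁, by simp only [hne, if_false]; cases d <;> cases b <;> simp_all⟩
    refine (hc.2 _ hbip).trans ?_
    rw [cost_eq_add_not _ b]
    have e1 : per (part (p ∘ f) (fun i => if i = i₀ then b else !b) b) ≤ 0 := by
      rw [← per_singleton (p (f i₀))]
      refine per_mono fun s hs => ?_
      obtain ⟨i, hi, rfl⟩ := mem_part.1 hs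
      by_cases h : i = i₀
      · simp [h]
      · simp [h] at hi
    have e2 : per (part (p ∘ f) (fun i => if i = i₀ then b else !b) (!b))
        ≤ per (part p c' (!b)) := per_mono fun s hs => by
      obtain ⟨i, -, rfl⟩ := mem_part.1 hs
      exact mem_part.2 ⟨f i, hb' i, rfl⟩
    linarith [per_part_le_cost (p := p) c' (!b)]

/-- An optimal bipartition of a set of representatives extends to a bipartition that is optimal up
to an additive error. -/
lemma IsOptimal.cost_comp_le {k : ℕ} (hk : 2 ≤ k) {f : Fin k → Fin n} {g : Fin n → Fin k}
    {c : Fin k → Bool} (hc : IsOptimal (p ∘ f) c) {δ : ℝ} (hδ : 0 ≤ δ)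
    (hg : ∀ i, dist (p i) (p (f (g i))) ≤ δ) (c' : Fin n → Bool) :
    cost p (c ∘ g) ≤ cost p c' + 4 * Real.pi * δ := by
  have (b : Bool) : per (part p (c ∘ g) b) ≤ per (part (p ∘ f) c b) + 2 * Real.pi * δ :=
    per_le_add hδ fun s hs => by
      obtain ⟨i, hi, rfl⟩ := mem_part.1 hs
      exact ⟨p (f (g i)), mem_part.2 ⟨g i, hi, rfl⟩, hg i⟩
  have h1 := this true
  have h2 := this false
  have h3 := hc.cost_le_of_comp hk c'
  unfold cost at h3 ⊢
  linarith

end Bipartitions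

/-! ### Straight-line code -/

/-- Registers and memory, without the program counter. -/
@[ext] structure Store : Type where
  reg : ℕ → ℝ
  mem : ℕ → ℝ

/-- The configuration with a given program counter. -/
def Store.at (σ : Store) (pc : ℕ) : Config := ⟨pc, σ.reg, σ.mem⟩

/-- The effect of an instruction on registers and memory. -/
def Instr.act (i : Instr) (σ : Store) : Store := ⟨(i.exec (σ.at 0)).reg, (i.exec (σ.at 0)).mem⟩

/-- All instructions except jumps. -/
def Instr.IsPlain : Instr → Prop
  | .jumpLe _ _ _ => False
  | _ => True

/-- The effect of a list of plain instructions. -/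
def run (l : List Instr) (σ : Store) : Store := l.foldl (fun σ i => i.act σ) σ

@[simp] lemma run_nil (σ : Store) : run [] σ = σ := rfl

@[simp] lemma run_cons (i : Instr) (l : List Instr) (σ : Store) :
    run (i :: l) σ = run l (i.act σ) := rfl

lemma run_append (l l' : List Instr) (σ : Store) : run (l ++ l') σ = run l' (run l σ) :=
  List.foldl_append

section Act
variable (σ : Store) (d a b : ℕ)

@[simp] lemma act_const (z : ℤ) :
    (Instr.const d z).act σ = ⟨Function.update σ.reg d z, σ.mem⟩ := rfl
@[simp] lemma act_move : (Instr.move d a).act σ = ⟨Function.update σ.reg d (σ.reg a), σ.mem⟩ := rfl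
@[simp] lemma act_add :
    (Instr.add d a b).act σ = ⟨Function.update σ.reg d (σ.reg a + σ.reg b), σ.mem⟩ := rfl
@[simp] lemma act_sub :
    (Instr.sub d a b).act σ = ⟨Function.update σ.reg d (σ.reg a - σ.reg b), σ.mem⟩ := rfl
@[simp] lemma act_mul :
    (Instr.mul d a b).act σ = ⟨Function.update σ.reg d (σ.reg a * σ.reg b), σ.mem⟩ := rfl
@[simp] lemma act_div :
    (Instr.div d a b).act σ = ⟨Function.update σ.reg d (σ.reg a / σ.reg b), σ.mem⟩ := rfl
@[simp] lemma act_sqrt :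
    (Instr.sqrt d a).act σ = ⟨Function.update σ.reg d √(σ.reg a), σ.mem⟩ := rfl
@[simp] lemma act_floor :
    (Instr.floor d a).act σ = ⟨Function.update σ.reg d ⌊σ.reg a⌋, σ.mem⟩ := rfl
@[simp] lemma act_dyadic : (Instr.dyadic d a b).act σ
    = ⟨Function.update σ.reg d (dyadicSide (σ.reg a) (σ.reg b)), σ.mem⟩ := rfl
@[simp] lemma act_load :
    (Instr.load d a).act σ = ⟨Function.update σ.reg d (σ.mem ⌊σ.reg a⌋₊), σ.mem⟩ := rfl
@[simp] lemma act_store :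
    (Instr.store d a).act σ = ⟨σ.reg, Function.update σ.mem ⌊σ.reg d⌋₊ (σ.reg a)⟩ := rfl

end Act

lemma Instr.exec_at {i : Instr} (hi : i.IsPlain) (σ : Store) (pc : ℕ) :
    i.exec (σ.at pc) = (i.act σ).at (pc + 1) := by
  cases i <;> first | rfl | exact hi.elim

lemma step_append (pre : Program) (i : Instr) (post : Program) (σ : Store) :
    step (pre ++ i :: post) (σ.at pre.length) = i.exec (σ.at pre.length) := by
  unfold step
  have : (pre ++ i :: post)[(σ.at pre.length).pc]? = some i := by simp [Store.at]
  rw [this]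

lemma iterate_step_straight {l : List Instr} (hl : ∀ i ∈ l, i.IsPlain) (σ : Store)
    (pre post : Program) :
    (step (pre ++ l ++ post))^[l.length] (σ.at pre.length)
      = (run l σ).at (pre.length + l.length) := by
  induction l generalizing σ pre with
  | nil => simp
  | cons i l ih =>
    have h := ih (fun j hj => hl j (List.mem_cons_of_mem _ hj)) (i.act σ) (pre ++ [i])
    rw [List.length_cons, Function.iterate_succ_apply]
    have e : step (pre ++ i :: l ++ post) (σ.at pre.length) = (i.act σ).at (pre.length + 1) := by
      rw [List.append_assoc, List.cons_append, step_append,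
        Instr.exec_at (hl i List.mem_cons_self)]
    rw [e]
    simp only [List.append_assoc, List.singleton_append, List.length_append, List.length_cons,
      List.length_nil, zero_add] at h ⊢
    rw [List.cons_append] at h ⊢
    rw [h, run_cons, add_assoc, add_comm 1]

/-! ### Structured programs -/

/-- Code of fixed length that depends on its position in the program. -/
structure Block : Type where
  len : ℕ
  code : ℕ → Program
  length_code : ∀ off, (code off).length = len

attribute [simp] Block.length_code

/-- Started at its first instruction on the store `σ`, the block reaches its end after at most `t`
steps, with a store that satisfies `Post`. -/
def Block.Runs (b : Block) (t : ℕ) (Post : Store → Prop) (σ : Store) : Prop :=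
  ∃ t' ≤ t, ∃ σ', Post σ' ∧ ∀ pre post : Program,
    (step (pre ++ b.code pre.length ++ post))^[t'] (σ.at pre.length) = σ'.at (pre.length + b.len)

lemma Block.Runs.mono {b : Block} {t t' : ℕ} {Post Post' : Store → Prop} {σ : Store}
    (h : b.Runs t Post σ) (ht : t ≤ t') (hP : ∀ σ', Post σ' → Post' σ') : b.Runs t' Post' σ := by
  obtain ⟨u, hu, σ', h1, h2⟩ := h
  exact ⟨u, hu.trans ht, σ', hP _ h1, h2⟩

/-- A block of plain instructions. -/
def straight (l : List Instr) : Block := ⟨l.length, fun _ => l, fun _ => rfl⟩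

lemma runs_straight {l : List Instr} (hl : ∀ i ∈ l, i.IsPlain) {Post : Store → Prop} {σ : Store}
    (h : Post (run l σ)) : (straight l).Runs l.length Post σ :=
  ⟨_, le_rfl, _, h, iterate_step_straight hl σ⟩

/-- Sequential composition. -/
def Block.seq (b b' : Block) : Block :=
  ⟨b.len + b'.len, fun off => b.code off ++ b'.code (off + b.len), fun off => by simp⟩

lemma Block.Runs.seq {b b' : Block} {t t' : ℕ} {Post : Store → Prop} {σ : Store}
    (h : b.Runs t (fun σ' => b'.Runs t' Post σ') σ) : (b.seq b').Runs (t + t') Post σ := by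
  obtain ⟨u, hu, σ', ⟨u', hu', σ'', hP, h2⟩, h1⟩ := h
  refine ⟨u' + u, by omega, σ'', hP, fun pre post => ?_⟩
  have e1 := h1 pre (b'.code (pre.length + b.len) ++ post)
  have e2 := h2 (pre ++ b.code pre.length) post
  simp only [List.append_assoc, List.length_append, Block.length_code, Block.seq] at e1 e2 ⊢
  rw [Function.iterate_add_apply, e1, e2, add_assoc]

/-- Execute `b` if register `r` is at most register `r'`, and `b'` otherwise. -/
def ifLe (r r' : ℕ) (b b' : Block) : Block :=
  ⟨b'.len + b.len + 2, fun off => Instr.jumpLe r r' (off + b'.len + 2) :: (b'.code (off + 1) ++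
    Instr.jumpLe 0 0 (off + b'.len + 2 + b.len) :: b.code (off + b'.len + 2)), fun off => by
      simp; omega⟩

lemma exec_jumpLe_pos {σ : Store} {r r' : ℕ} (h : σ.reg r ≤ σ.reg r') (l pc : ℕ) :
    (Instr.jumpLe r r' l).exec (σ.at pc) = σ.at l := if_pos h

lemma exec_jumpLe_neg {σ : Store} {r r' : ℕ} (h : ¬ σ.reg r ≤ σ.reg r') (l pc : ℕ) :
    (Instr.jumpLe r r' l).exec (σ.at pc) = σ.at (pc + 1) := if_neg h

/-- The code of b' comes first. Besides the test, that branch needs an unconditional jump over b,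
which accounts for the two extra steps. -/
lemma runs_ifLe {r r' : ℕ} {b b' : Block} {t : ℕ} {Post : Store → Prop} {σ : Store}
    (h : σ.reg r ≤ σ.reg r' → b.Runs t Post σ) (h' : σ.reg r' < σ.reg r → b'.Runs t Post σ) :
    (ifLe r r' b b').Runs (t + 2) Post σ := by
  by_cases hr : σ.reg r ≤ σ.reg r'
  · obtain ⟨u, hu, σ', hP, h1⟩ := h hr
    refine ⟨u + 1, by omega, σ', hP, fun pre post => ?_⟩
    have e := h1 (pre ++ Instr.jumpLe r r' (pre.length + b'.len + 2) :: (b'.code (pre.length + 1)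
      ++ [Instr.jumpLe 0 0 (pre.length + b'.len + 2 + b.len)])) post
    have el : (pre ++ Instr.jumpLe r r' (pre.length + b'.len + 2) :: (b'.code (pre.length + 1)
      ++ [Instr.jumpLe 0 0 (pre.length + b'.len + 2 + b.len)])).length
        = pre.length + b'.len + 2 := by simp; omega
    rw [el] at e
    simp only [List.append_assoc, List.cons_append, List.nil_append, ifLe] at e ⊢
    rw [Function.iterate_succ_apply, step_append, exec_jumpLe_pos hr, e]
    congr 1; omega
  · obtain ⟨u, hu, σ', hP, h1⟩ := h' (not_le.1 hr)
    refine ⟨1 + u + 1, by omega, σ', hP, fun pre post => ?_⟩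
    have e := h1 (pre ++ [Instr.jumpLe r r' (pre.length + b'.len + 2)])
      (Instr.jumpLe 0 0 (pre.length + b'.len + 2 + b.len) :: (b.code (pre.length + b'.len + 2)
        ++ post))
    have e2 := step_append (pre ++ Instr.jumpLe r r' (pre.length + b'.len + 2) ::
      b'.code (pre.length + 1)) (Instr.jumpLe 0 0 (pre.length + b'.len + 2 + b.len))
      (b.code (pre.length + b'.len + 2) ++ post) σ'
    have el : (pre ++ Instr.jumpLe r r' (pre.length + b'.len + 2) ::
      b'.code (pre.length + 1)).length = pre.length + 1 + b'.len := by simp; omega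
    rw [el, exec_jumpLe_pos le_rfl] at e2
    simp only [List.append_assoc, List.cons_append, List.nil_append, ifLe, List.length_append,
      List.length_cons, List.length_nil, zero_add] at e e2 ⊢
    rw [Function.iterate_succ_apply, step_append, exec_jumpLe_neg hr,
      Function.iterate_add_apply, e, Function.iterate_one, e2]
    congr 1; omega

/-- Repeat `b` while register `r` is less than register `r'`. -/
def whileLt (r r' : ℕ) (b : Block) : Block :=
  ⟨b.len + 2, fun off => Instr.jumpLe r' r (off + b.len + 2) ::
    (b.code (off + 1) ++ [Instr.jumpLe 0 0 off]), fun off => by simp⟩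

/-- A loop with a counter: the invariant `I i` holds after `i` of `n` iterations. -/
lemma runs_whileLt {r r' : ℕ} {b : Block} {t n : ℕ} (I : ℕ → Store → Prop)
    (hreg : ∀ i σ, I i σ → σ.reg r = i ∧ σ.reg r' = n)
    (hb : ∀ i σ, i < n → I i σ → b.Runs t (I (i + 1)) σ) {σ : Store} (h : I 0 σ) :
    (whileLt r r' b).Runs (n * (t + 2) + 1) (I n) σ := by
  -- Induction on the number k of remaining iterations. Each pays for the test and the jump back;
  -- the last 1 is the test that leaves the loop.
  suffices H : ∀ k i σ, i + k = n → I i σ →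
      (whileLt r r' b).Runs (k * (t + 2) + 1) (I n) σ from H n 0 σ (zero_add n) h
  intro k
  induction k with
  | zero =>
    intro i σ hi hI
    obtain ⟨h1, h2⟩ := hreg i σ hI
    obtain rfl : i = n := by omega
    refine ⟨1, by omega, σ, hI, fun pre post => ?_⟩
    simp only [whileLt, List.append_assoc, List.cons_append]
    rw [Function.iterate_one, step_append, exec_jumpLe_pos (by rw [h1, h2])]
    congr 1
  | succ k ih =>
    intro i σ hi hI
    obtain ⟨h1, h2⟩ := hreg i σ hI
    obtain ⟨u, hu, σ', hI', e1⟩ := hb i σ (by omega) hI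
    obtain ⟨u', hu', σ'', hI'', e2⟩ := ih (i + 1) σ' (by omega) hI'
    refine ⟨u' + 1 + u + 1, by rw [add_one_mul]; omega, σ'', hI'', fun pre post => ?_⟩
    have hlt : ¬ σ.reg r' ≤ σ.reg r := by
      rw [h1, h2, not_le]; exact_mod_cast (by omega : i < n)
    have e3 := e1 (pre ++ [Instr.jumpLe r' r (pre.length + b.len + 2)])
      (Instr.jumpLe 0 0 pre.length :: post)
    have e4 := step_append (pre ++ Instr.jumpLe r' r (pre.length + b.len + 2) ::
      b.code (pre.length + 1)) (Instr.jumpLe 0 0 pre.length) post σ'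
    have el : (pre ++ Instr.jumpLe r' r (pre.length + b.len + 2) ::
      b.code (pre.length + 1)).length = pre.length + 1 + b.len := by simp; omega
    have e5 := e2 pre post
    rw [el, exec_jumpLe_pos le_rfl] at e4
    simp only [List.append_assoc, List.cons_append, List.nil_append, whileLt, List.length_append,
      List.length_cons, List.length_nil, zero_add] at e3 e4 e5 ⊢
    rw [Function.iterate_succ_apply, step_append, exec_jumpLe_neg hlt,
      Function.iterate_add_apply, e3, Function.iterate_add_apply, Function.iterate_one, e4, e5]

/-- A block that runs on the input store is a halting program. -/
lemma Block.Runs.haltsWithin {b : Block} {t : ℕ} {Post : Store → Prop} {l : List ℝ}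
    (h : b.Runs t Post ⟨fun _ => 0, fun i => l.getD i 0⟩) :
    ∃ t' ≤ t, ∃ σ', Post σ' ∧ HaltsWithin (b.code 0) l t' σ'.mem := by
  obtain ⟨t', ht', σ', hP, h1⟩ := h
  refine ⟨t', ht', σ', hP, ?_⟩
  have := h1 [] []
  simp only [List.nil_append, List.append_nil, List.length_nil, zero_add] at this
  have e : start l = Store.at ⟨fun _ => 0, fun i => l.getD i 0⟩ 0 := rfl
  unfold HaltsWithin
  rw [e, this]
  exact ⟨(b.length_code 0).le, rfl⟩

/-! ### Running a program inside another program

The registers of the inner program are shifted by `32`, and its memory is shifted by the content of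
register `19`. Register `2` contains the number `2`, and register `23` is used for addresses. -/

/-- Instructions that put the address `max x 0 + base` in register `23`, where `x` is the content
of register `a` of the inner program. -/
def shiftAddress (a : ℕ) : List Instr :=
  [.mul 23 (a + 32) (a + 32), .sqrt 23 23, .add 23 23 (a + 32), .div 23 23 2, .add 23 23 19]

/-- The translation of one instruction of a program with `L` instructions, translated from position
`off` on: always six instructions. -/
def Instr.embed (off L : ℕ) : Instr → List Instr
  | .const d z => .const (d + 32) z :: List.replicate 5 (.move 23 23)
  | .move d a => .move (d + 32) (a + 32) :: List.replicate 5 (.move 23 23)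
  | .add d a b => .add (d + 32) (a + 32) (b + 32) :: List.replicate 5 (.move 23 23)
  | .sub d a b => .sub (d + 32) (a + 32) (b + 32) :: List.replicate 5 (.move 23 23)
  | .mul d a b => .mul (d + 32) (a + 32) (b + 32) :: List.replicate 5 (.move 23 23)
  | .div d a b => .div (d + 32) (a + 32) (b + 32) :: List.replicate 5 (.move 23 23)
  | .sqrt d a => .sqrt (d + 32) (a + 32) :: List.replicate 5 (.move 23 23)
  | .floor d a => .floor (d + 32) (a + 32) :: List.replicate 5 (.move 23 23)
  | .dyadic d a b => .dyadic (d + 32) (a + 32) (b + 32) :: List.replicate 5 (.move 23 23)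
  | .load d a => shiftAddress a ++ [.load (d + 32) 23]
  | .store d a => shiftAddress d ++ [.store 23 (a + 32)]
  -- Targets outside the program are clamped to its end, so halting of the inner program means
  -- reaching the end of the block.
  | .jumpLe a b l =>
    .jumpLe (a + 32) (b + 32) (off + 6 * min l L) :: List.replicate 5 (.move 23 23)

lemma Instr.length_embed (off L : ℕ) (i : Instr) : (i.embed off L).length = 6 := by
  cases i <;> rfl

lemma Instr.isPlain_of_mem_embed {off L : ℕ} {i j : Instr} (hi : i.IsPlain)
    (hj : j ∈ i.embed off L) : j.IsPlain := by
  cases i <;> first | exact hi.elim | skip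
  all_goals
    simp only [Instr.embed, shiftAddress, List.replicate, List.cons_append, List.nil_append,
      List.mem_cons, List.not_mem_nil, or_false] at hj
    rcases hj with rfl | rfl | rfl | rfl | rfl | rfl <;> trivial

lemma length_flatMap_embed (off L : ℕ) (A : Program) :
    (A.flatMap (Instr.embed off L)).length = 6 * A.length := by
  induction A with
  | nil => rfl
  | cons i A ih =>
    rw [List.flatMap_cons, List.length_append, ih, Instr.length_embed, List.length_cons]; ring

/-- The program `A` as a part of another program. -/
def embedded (A : Program) : Block :=
  ⟨6 * A.length, fun off => A.flatMap (Instr.embed off A.length), fun off =>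
    length_flatMap_embed off _ A⟩

/-- The store `σ'` of the outer program contains the store `σ` of the inner program, whose memory
starts at `base`, and outside it agrees with `σ₀`. -/
structure Simulates (base : ℕ) (σ₀ σ σ' : Store) : Prop where
  two : σ₀.reg 2 = 2
  reg_base : σ₀.reg 19 = base
  reg : ∀ r, σ'.reg (r + 32) = σ.reg r
  mem : ∀ j, σ'.mem (base + j) = σ.mem j
  outer_reg : ∀ r, r < 32 → r ≠ 23 → σ'.reg r = σ₀.reg r
  outer_mem : ∀ j, j < base → σ'.mem j = σ₀.mem j

/-- `Nat.floor` sends negative contents to address 0, so the base may only be added after truncating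
at 0. The formula (√(x²) + x)/2 does this without a branch. -/
lemma floor_shifted_address (x : ℝ) (base : ℕ) :
    ⌊(√(x * x) + x) / 2 + base⌋₊ = base + ⌊x⌋₊ := by
  rw [Real.sqrt_mul_self_eq_abs, add_comm (base : ℕ)]
  rcases le_total 0 x with h | h
  · rw [abs_of_nonneg h, add_self_div_two, Nat.floor_add_natCast h]
  · rw [abs_of_nonpos h, Nat.floor_of_nonpos h, neg_add_cancel, zero_div, zero_add,
      Nat.floor_natCast, zero_add]

lemma Simulates.run_shiftAddress {base : ℕ} {σ₀ σ σ' : Store} (h : Simulates base σ₀ σ σ')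
    (a : ℕ) : ∃ x, run (shiftAddress a) σ' = ⟨Function.update σ'.reg 23 x, σ'.mem⟩ ∧
      ⌊x⌋₊ = base + ⌊σ.reg a⌋₊ := by
  refine ⟨_, ?_, floor_shifted_address (σ.reg a) base⟩
  have h2 := (h.outer_reg 2 (by norm_num) (by norm_num)).trans h.two
  have h19 := (h.outer_reg 19 (by norm_num) (by norm_num)).trans h.reg_base
  have ha : ¬ a + 32 = 23 := by omega
  simp [shiftAddress, h2, h19, h.reg, ha]

lemma Simulates.embed {base : ℕ} {σ₀ σ σ' : Store} (h : Simulates base σ₀ σ σ')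
    {i : Instr} (hi : i.IsPlain) (off L : ℕ) :
    Simulates base σ₀ (i.act σ) (run (i.embed off L) σ') := by
  -- The scratch register 23 may change arbitrarily; this covers the address computation that
  -- precedes a memory access.
  have key : ∀ (d : ℕ) (v : ℝ) (x : ℝ), Simulates base σ₀ ⟨Function.update σ.reg d v, σ.mem⟩
      ⟨Function.update (Function.update σ'.reg 23 x) (d + 32) v, σ'.mem⟩ := fun d v x =>
    { two := h.two
      reg_base := h.reg_base
      reg := fun r => by
        simp only [Function.update_apply, add_left_inj, h.reg]
        simp [show ¬ r + 32 = 23 by omega]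
      mem := h.mem
      outer_reg := fun r hr hr' => by
        simp [hr', show ¬ r = d + 32 by omega, h.outer_reg r hr hr']
      outer_mem := h.outer_mem }
  have key' : ∀ (d : ℕ) (v : ℝ), Simulates base σ₀ ⟨Function.update σ.reg d v, σ.mem⟩
      ⟨Function.update σ'.reg (d + 32) v, σ'.mem⟩ := fun d v => by
    have := key d v (σ'.reg 23); rwa [Function.update_eq_self] at this
  have nop : ∀ τ : Store, run (List.replicate 5 (.move 23 23)) τ = τ := fun τ => by
    simp [List.replicate]
  cases i with
  | jumpLe => exact hi.elim
  | load d a =>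
    obtain ⟨x, hx, hx'⟩ := h.run_shiftAddress a
    simp only [Instr.embed, run_append, hx, run_cons, run_nil, act_load, Function.update_self,
      hx', h.mem]
    exact key _ _ _
  | store d a =>
    obtain ⟨x, hx, hx'⟩ := h.run_shiftAddress d
    have ha : ¬ a + 32 = 23 := by omega
    simp only [Instr.embed, run_append, hx, run_cons, run_nil, act_store, Function.update_self,
      hx', Function.update_apply σ'.reg, ha, if_false, h.reg]
    exact
    { two := h.two
      reg_base := h.reg_base
      reg := fun r => by simp [show ¬ r + 32 = 23 by omega, h.reg]
      mem := fun j => by simp [Function.update_apply, h.mem]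
      outer_reg := fun r hr hr' => by simp [hr', h.outer_reg r hr hr']
      outer_mem := fun j hj => by
        simp [show ¬ j = base + ⌊σ.reg d⌋₊ by omega, h.outer_mem j hj] }
  | _ =>
    simp only [Instr.embed, run_cons, act_const, act_move, act_add, act_sub, act_mul, act_div,
      act_sqrt, act_floor, act_dyadic, h.reg, nop]
    exact key' _ _

lemma step_of_halted {Q : Program} {s : Config} (h : Q.length ≤ s.pc) : step Q s = s := by
  unfold step
  rw [List.getElem?_eq_none h]

/-- While the inner program makes `t` steps, the outer program makes at most `6 t` steps. -/
lemma iterate_step_embedded {A : Program} {base : ℕ} {σ₀ : Store} (t : ℕ) {s : Config}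
    {σ' : Store} (h : Simulates base σ₀ ⟨s.reg, s.mem⟩ σ') :
    ∃ t' ≤ 6 * t, ∃ σ'', Simulates base σ₀ ⟨((step A)^[t] s).reg, ((step A)^[t] s).mem⟩ σ'' ∧
      ∀ pre post : Program, (step (pre ++ (embedded A).code pre.length ++ post))^[t']
        (σ'.at (pre.length + 6 * min s.pc A.length))
          = σ''.at (pre.length + 6 * min ((step A)^[t] s).pc A.length) := by
  induction t generalizing s σ' with
  | zero => exact ⟨0, by omega, σ', h, fun pre post => rfl⟩
  | succ t ih =>
    -- A halted inner program no longer moves, and the outer one spends no steps on it.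
    rcases le_or_gt A.length s.pc with hpc | hpc
    · obtain ⟨t', ht', hex⟩ := ih h
      refine ⟨t', by omega, ?_⟩
      rw [Function.iterate_succ_apply, step_of_halted hpc]
      exact hex
    obtain ⟨A₁, i, A₂, hA, hA₁⟩ : ∃ A₁ i A₂, A = A₁ ++ i :: A₂ ∧ A₁.length = s.pc :=
      ⟨A.take s.pc, A[s.pc], A.drop (s.pc + 1), by simp, by simp; omega⟩
    have hstep : step A s = i.exec s := by
      have := step_append A₁ i A₂ ⟨s.reg, s.mem⟩
      rw [← hA, hA₁] at this
      exact this
    have hcode : ∀ pre post : Program, pre ++ (embedded A).code pre.length ++ post =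
        (pre ++ A₁.flatMap (Instr.embed pre.length A.length)) ++ i.embed pre.length A.length ++
          (A₂.flatMap (Instr.embed pre.length A.length) ++ post) := fun pre post => by
      simp only [embedded]
      conv_lhs => rw [show A.flatMap (Instr.embed pre.length A.length)
        = (A₁ ++ i :: A₂).flatMap (Instr.embed pre.length A.length) by rw [← hA]]
      simp
    have hlen : ∀ pre : Program, pre.length + 6 * min s.pc A.length
        = (pre ++ A₁.flatMap (Instr.embed pre.length A.length)).length := fun pre => by
      rw [List.length_append, length_flatMap_embed, hA₁, min_eq_left hpc.le]
    by_cases hi : i.IsPlain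
    · have hs : i.exec s = (i.act ⟨s.reg, s.mem⟩).at (s.pc + 1) := Instr.exec_at hi ⟨s.reg, s.mem⟩ _
      have hrun : ∀ off, run (i.embed off A.length) σ' = run (i.embed 0 A.length) σ' := fun off =>
        by cases i <;> first | rfl | exact hi.elim
      obtain ⟨t', ht', σ'', hsim, hex⟩ := ih (s := step A s)
        (σ' := run (i.embed 0 A.length) σ') (by rw [hstep, hs]; exact h.embed hi _ _)
      refine ⟨t' + 6, by omega, σ'', by rw [Function.iterate_succ_apply]; exact hsim,
        fun pre post => ?_⟩
      have e := iterate_step_straight (fun j hj => Instr.isPlain_of_mem_embed hi hj) σ'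
        (pre ++ A₁.flatMap (Instr.embed pre.length A.length))
        (l := i.embed pre.length A.length)
        (A₂.flatMap (Instr.embed pre.length A.length) ++ post)
      rw [← hcode, ← hlen, Instr.length_embed, hrun] at e
      rw [Function.iterate_add_apply, e, Function.iterate_succ_apply, ← hex pre post]
      congr 2
      rw [hstep, hs]
      simp only [Store.at]
      omega
    · obtain ⟨a, b, l, rfl⟩ : ∃ a b l, i = .jumpLe a b l := by
        cases i <;> first | exact ⟨_, _, _, rfl⟩ | exact absurd trivial hi
      by_cases hab : s.reg a ≤ s.reg b
      · have hs : step A s = ⟨l, s.reg, s.mem⟩ := hstep.trans (if_pos hab)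
        obtain ⟨t', ht', σ'', hsim, hex⟩ := ih (s := step A s) (σ' := σ') (by rw [hs]; exact h)
        refine ⟨t' + 1, by omega, σ'', by rw [Function.iterate_succ_apply]; exact hsim,
          fun pre post => ?_⟩
        rw [Function.iterate_succ_apply, Function.iterate_succ_apply, ← hex pre post]
        congr 1
        rw [hcode, hlen, Instr.embed, List.append_assoc, List.cons_append, step_append,
          exec_jumpLe_pos (by rw [h.reg, h.reg]; exact hab), hs]
      · have hs : step A s = ⟨s.pc + 1, s.reg, s.mem⟩ := hstep.trans (if_neg hab)
        obtain ⟨t', ht', σ'', hsim, hex⟩ := ih (s := step A s) (σ' := σ') (by rw [hs]; exact h)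
        -- A jump that is not taken falls through the five padding instructions.
        refine ⟨t' + 5 + 1, by omega, σ'', by rw [Function.iterate_succ_apply]; exact hsim,
          fun pre post => ?_⟩
        have e1 : step (pre ++ (embedded A).code pre.length ++ post)
            (σ'.at (pre.length + 6 * min s.pc A.length))
              = σ'.at (pre.length + 6 * min s.pc A.length + 1) := by
          rw [hcode, hlen, Instr.embed, List.append_assoc, List.cons_append, step_append,
            exec_jumpLe_neg (by rw [h.reg, h.reg]; exact hab)]
        have e2 := iterate_step_straight (l := List.replicate 5 (.move 23 23))
          (fun j hj => by rw [List.eq_of_mem_replicate hj]; trivial) σ'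
          (pre ++ A₁.flatMap (Instr.embed pre.length A.length)
            ++ [.jumpLe (a + 32) (b + 32) (pre.length + 6 * min l A.length)])
          (A₂.flatMap (Instr.embed pre.length A.length) ++ post)
        have e3 : run (List.replicate 5 (.move 23 23)) σ' = σ' := by simp [List.replicate]
        have e4 : pre ++ A₁.flatMap (Instr.embed pre.length A.length)
            ++ [.jumpLe (a + 32) (b + 32) (pre.length + 6 * min l A.length)]
            ++ List.replicate 5 (.move 23 23)
            ++ (A₂.flatMap (Instr.embed pre.length A.length) ++ post)
            = pre ++ (embedded A).code pre.length ++ post := by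
          rw [hcode, Instr.embed]; simp
        rw [e4, e3, List.length_append, ← hlen, List.length_replicate, List.length_singleton] at e2
        rw [Function.iterate_succ_apply, e1, Function.iterate_add_apply, e2,
          Function.iterate_succ_apply, ← hex pre post]
        congr 2
        rw [hs]
        simp only
        omega

lemma runs_embedded {A : Program} {l : List ℝ} {t base : ℕ} {m : ℕ → ℝ} {σ : Store}
    (hA : HaltsWithin A l t m)
    (h : Simulates base σ ⟨fun _ => 0, fun i => l.getD i 0⟩ σ) :
    (embedded A).Runs (6 * t) (fun σ' => (∀ j, σ'.mem (base + j) = m j) ∧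
      (∀ r, r < 32 → r ≠ 23 → σ'.reg r = σ.reg r) ∧ ∀ j, j < base → σ'.mem j = σ.mem j) σ := by
  obtain ⟨t', ht', σ'', hsim, hex⟩ := iterate_step_embedded (A := A) t (s := start l) h
  refine ⟨t', ht', σ'', ⟨fun j => ?_, hsim.outer_reg, hsim.outer_mem⟩, fun pre post => ?_⟩
  · rw [hsim.mem, ← hA.2]
  · have := hex pre post
    rw [min_eq_right hA.1] at this
    simpa [start, embedded] using this

/-! ### The input in memory -/

lemma getD_coords {n : ℕ} (p : Fin n → Plane) (i : Fin n) :
    (coords p).getD (2 * i) 0 = p i 0 ∧ (coords p).getD (2 * i + 1) 0 = p i 1 := by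
  induction n with
  | zero => exact i.elim0
  | succ n ih =>
    have e : coords p = p 0 0 :: p 0 1 :: coords (fun i => p i.succ) := by
      simp [coords, List.ofFn_succ]
    rw [e]
    refine Fin.cases ?_ (fun i => ?_) i
    · simp
    · have := ih (fun i => p i.succ) i
      rw [Fin.val_succ, show 2 * (i.val + 1) = 2 * i.val + 1 + 1 by ring]
      simpa using this

lemma length_coords {n : ℕ} (p : Fin n → Plane) : (coords p).length = 2 * n := by
  simp [coords, Function.comp_def, List.sum_replicate, mul_comm]

/-- A memory that contains the size and the coordinates of a point set, followed by zeros. -/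
lemma eq_getD_cons_coords {n : ℕ} {p : Fin n → Plane} {m : ℕ → ℝ} (h0 : m 0 = n)
    (h : ∀ i : Fin n, m (2 * i + 1) = p i 0 ∧ m (2 * i + 2) = p i 1)
    (hz : ∀ j, 2 * n < j → m j = 0) (j : ℕ) : m j = ((n : ℝ) :: coords p).getD j 0 := by
  rcases j with _ | j
  · simp [h0]
  rw [List.getD_cons_succ]
  by_cases hj : j < 2 * n
  · obtain ⟨q, hq⟩ : ∃ q, q = j / 2 := ⟨_, rfl⟩
    have hqn : q < n := by omega
    obtain ⟨h1, h2⟩ := h ⟨q, hqn⟩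
    obtain ⟨h3, h4⟩ := getD_coords p ⟨q, hqn⟩
    rcases Nat.mod_two_eq_zero_or_one j with hm | hm
    · rw [show j = 2 * q by omega]; rw [h3]; exact h1
    · rw [show j = 2 * q + 1 by omega]; rw [h4]; exact h2
  · rw [hz _ (by omega), List.getD_eq_default _ _ (by rw [length_coords]; omega)]

/-! ### Frame conditions -/

/-- Registers below `b` and registers from `32` on keep their contents. -/
def Keeps (b : ℕ) (σ σ' : Store) : Prop := ∀ r, r < b ∨ 32 ≤ r → σ'.reg r = σ.reg r

lemma Keeps.refl (b : ℕ) (σ : Store) : Keeps b σ σ := fun _ _ => rfl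

lemma Keeps.trans {b b' : ℕ} {σ σ' σ'' : Store} (h : Keeps b σ σ') (h' : Keeps b' σ' σ'')
    (hb : b ≤ b') : Keeps b σ σ'' := fun r hr =>
  (h' r (hr.imp_left fun h => h.trans_le hb)).trans (h r hr)

/-- The target register of the instruction is at least `b` and below `32`. -/
def Instr.WritesFrom (b : ℕ) : Instr → Prop
  | .const d _ | .move d _ | .add d _ _ | .sub d _ _ | .mul d _ _ | .div d _ _ | .sqrt d _
  | .floor d _ | .dyadic d _ _ | .load d _ => b ≤ d ∧ d < 32
  | .store _ _ | .jumpLe _ _ _ => True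

lemma Instr.WritesFrom.keeps {b : ℕ} {i : Instr} (hi : i.WritesFrom b) (σ : Store) :
    Keeps b σ (i.act σ) := by
  intro r hr
  cases i
  case store => rfl
  case jumpLe => simp only [Instr.act, Instr.exec]; split_ifs <;> rfl
  all_goals
    simp only [Instr.WritesFrom] at hi
    exact Function.update_of_ne (by omega) _ _

lemma keeps_run {b : ℕ} {l : List Instr} (hl : ∀ i ∈ l, i.WritesFrom b) (σ : Store) :
    Keeps b σ (run l σ) := by
  induction l generalizing σ with
  | nil => exact Keeps.refl b σ
  | cons i l ih =>
    exact ((hl i List.mem_cons_self).keeps σ).trans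
      (ih (fun j hj => hl j (List.mem_cons_of_mem _ hj)) _) le_rfl

/-! ### Reading points and computing distances -/

/-- Load the point whose number is in register `22` to registers `24` and `25`. -/
def fetch : List Instr :=
  [.add 23 22 22, .add 23 23 2, .load 24 23, .add 23 23 1, .load 25 23]

/-- Put the squared distance of the point in registers `24` and `25` to the point in registers `a`
and `b` into register `d`. -/
def distTo (d a b : ℕ) : List Instr :=
  [.sub 26 24 a, .sub 27 25 b, .mul 26 26 26, .mul 27 27 27, .add d 26 27]

/-- The constants in registers `0`, …, `4`, and the size, the accuracy and the first point in
registers `5`, …, `8`. -/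
structure Setup (n : ℕ) (ε : ℝ) (z : Plane) (σ : Store) : Prop where
  r0 : σ.reg 0 = 0
  r1 : σ.reg 1 = 1
  r2 : σ.reg 2 = 2
  r3 : σ.reg 3 = 256
  r4 : σ.reg 4 = 128
  r5 : σ.reg 5 = n
  r6 : σ.reg 6 = ε
  r7 : σ.reg 7 = z 0
  r8 : σ.reg 8 = z 1

lemma Setup.of_eq {n : ℕ} {ε : ℝ} {z : Plane} {σ σ' : Store} (h : Setup n ε z σ)
    (hk : ∀ r, r < 9 → σ'.reg r = σ.reg r) : Setup n ε z σ' := by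
  constructor
  · rw [hk _ (by norm_num)]; exact h.r0
  · rw [hk _ (by norm_num)]; exact h.r1
  · rw [hk _ (by norm_num)]; exact h.r2
  · rw [hk _ (by norm_num)]; exact h.r3
  · rw [hk _ (by norm_num)]; exact h.r4
  · rw [hk _ (by norm_num)]; exact h.r5
  · rw [hk _ (by norm_num)]; exact h.r6
  · rw [hk _ (by norm_num)]; exact h.r7
  · rw [hk _ (by norm_num)]; exact h.r8

lemma Setup.of_keeps {n : ℕ} {ε : ℝ} {z : Plane} {σ σ' : Store} (h : Setup n ε z σ) {b : ℕ}
    (hk : Keeps b σ σ') (hb : 9 ≤ b) : Setup n ε z σ' :=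
  h.of_eq fun r hr => hk r (Or.inl (by omega))

/-- The memory contains the point `s` as the point with number `i`. -/
def HasPoint (m : ℕ → ℝ) (i : ℕ) (s : Plane) : Prop :=
  m (2 * i + 2) = s 0 ∧ m (2 * i + 3) = s 1

lemma hasPoint_input {n : ℕ} (p : Fin n → Plane) (x y : ℝ) (i : Fin n) :
    HasPoint (fun j => (x :: y :: coords p).getD j 0) i (p i) := by
  obtain ⟨h1, h2⟩ := getD_coords p i
  simp only [HasPoint]
  rw [show 2 * i.val + 2 = 2 * i.val + 1 + 1 by ring,
    show 2 * i.val + 3 = 2 * i.val + 1 + 1 + 1 by ring]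
  simpa using ⟨h1, h2⟩

lemma run_fetch {n : ℕ} {ε : ℝ} {z : Plane} {σ : Store} (h : Setup n ε z σ) {i : ℕ} {s : Plane}
    (h22 : σ.reg 22 = i) (hs : HasPoint σ.mem i s) :
    (run fetch σ).reg 24 = s 0 ∧ (run fetch σ).reg 25 = s 1 ∧ (run fetch σ).mem = σ.mem := by
  have e1 : ⌊(i : ℝ) + i + 2⌋₊ = 2 * i + 2 := by
    rw [← Nat.floor_natCast (R := ℝ) (2 * i + 2)]; congr 1; push_cast; ring
  have e2 : ⌊(i : ℝ) + i + 2 + 1⌋₊ = 2 * i + 3 := by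
    rw [← Nat.floor_natCast (R := ℝ) (2 * i + 3)]; congr 1; push_cast; ring
  simp [fetch, h22, h.r1, h.r2, e1, e2, hs.1, hs.2]

lemma keeps_fetch (σ : Store) : Keeps 23 σ (run fetch σ) :=
  keeps_run (by simp [fetch, Instr.WritesFrom]) σ

lemma dist_sq_eq (s t : Plane) :
    dist s t ^ 2 = (s 0 - t 0) * (s 0 - t 0) + (s 1 - t 1) * (s 1 - t 1) := by
  rw [EuclideanSpace.dist_eq, Fin.sum_univ_two, Real.sq_sqrt (by positivity), Real.dist_eq,
    Real.dist_eq, sq_abs, sq_abs, sq, sq]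

lemma run_distTo {σ : Store} {d a b : ℕ} {s t : Plane} (h24 : σ.reg 24 = s 0)
    (h25 : σ.reg 25 = s 1) (ha : σ.reg a = t 0) (hb : σ.reg b = t 1) (hb' : b ≠ 26) :
    (run (distTo d a b) σ).reg d = dist s t ^ 2 ∧ (run (distTo d a b) σ).mem = σ.mem := by
  simp [distTo, h24, h25, ha, hb, hb', dist_sq_eq]

lemma keeps_distTo {d : ℕ} (hd : 28 ≤ d ∧ d < 32) (a b : ℕ) (σ : Store) :
    Keeps 26 σ (run (distTo d a b) σ) :=
  keeps_run (by simp [distTo, Instr.WritesFrom]; omega) σ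

/-- Load a point and compute the squared distance to the first point. -/
lemma run_fetch_distTo {n : ℕ} {ε : ℝ} {z : Plane} {σ : Store} (h : Setup n ε z σ) {i : ℕ}
    {s : Plane} (h22 : σ.reg 22 = i) (hs : HasPoint σ.mem i s) :
    (run (fetch ++ distTo 28 7 8) σ).reg 24 = s 0 ∧ (run (fetch ++ distTo 28 7 8) σ).reg 25 = s 1 ∧
    (run (fetch ++ distTo 28 7 8) σ).reg 28 = dist s z ^ 2 ∧
    (run (fetch ++ distTo 28 7 8) σ).mem = σ.mem ∧
    Keeps 23 σ (run (fetch ++ distTo 28 7 8) σ) := by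
  obtain ⟨h1, h2, h3⟩ := run_fetch h h22 hs
  have hk := keeps_fetch σ
  have hS := h.of_keeps hk (by norm_num)
  obtain ⟨h4, h5⟩ := run_distTo (d := 28) h1 h2 hS.r7 hS.r8 (by norm_num)
  have hk' := keeps_distTo (d := 28) (by norm_num) 7 8 (run fetch σ)
  rw [run_append]
  exact ⟨(hk' 24 (by norm_num)).trans h1, (hk' 25 (by norm_num)).trans h2, h4, h5.trans h3,
    hk.trans hk' (by norm_num)⟩

/-! ### The phases of the approximation scheme: preparation and well-clustered inputs -/

/-- Set up constants and load size, accuracy and the first point. -/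
def prepare : Block := straight
  -- Registers 0, 1 and 2 double as the addresses of n, ε and the first coordinate. The constant 256
  -- serves both as 16² in the distance tests and as the numerator of 256/ε.
  [.const 1 1, .const 2 2, .const 3 256, .const 4 128, .load 5 0, .load 6 1, .load 7 2,
    .const 23 3, .load 8 23]

lemma runs_prepare {n : ℕ} (p : Fin n → Plane) (ε : ℝ) (i₀ : Fin n) (h0 : i₀.val = 0) :
    prepare.Runs 9 (fun σ => Setup n ε (p i₀) σ ∧ (∀ r, 9 ≤ r → r ≠ 23 → σ.reg r = 0) ∧
      σ.mem = fun j => ((n : ℝ) :: ε :: coords p).getD j 0)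
      ⟨fun _ => 0, fun j => ((n : ℝ) :: ε :: coords p).getD j 0⟩ := by
  refine runs_straight (by simp [Instr.IsPlain]) ?_
  obtain ⟨h1, h2⟩ := hasPoint_input p n ε i₀
  simp only [h0, mul_zero, zero_add] at h1 h2
  have e3 : ⌊(3 : ℝ)⌋₊ = 3 := Nat.floor_ofNat 3
  have e2 : ⌊(2 : ℝ)⌋₊ = 2 := Nat.floor_ofNat 2
  refine ⟨?_, ?_, rfl⟩
  · constructor <;> simp only [run_cons, run_nil, act_const, act_load] <;>
      (try simp only [e2, e3]) <;> simp [-List.getD_eq_getElem?_getD] <;>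
      first | exact h1 | exact h2 | rfl
  · intro r hr hr'
    simp only [run_cons, run_nil, act_const, act_load]
    simp only [Function.update_apply]
    simp [hr', show r ≠ 1 by omega, show r ≠ 2 by omega, show r ≠ 3 by omega,
      show r ≠ 4 by omega, show r ≠ 5 by omega, show r ≠ 6 by omega, show r ≠ 7 by omega,
      show r ≠ 8 by omega]

/-- The empty block. -/
def skip : Block := straight []

lemma runs_skip {t : ℕ} {Post : Store → Prop} {σ : Store} (h : Post σ) : skip.Runs t Post σ :=
  (runs_straight (l := []) (by simp) h).mono (Nat.zero_le t) fun _ h => h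

/-- Increase the loop counter. -/
def next : Block := straight [.add 22 22 1]

lemma runs_next {Post : Store → Prop} {σ : Store}
    (h : Post ⟨Function.update σ.reg 22 (σ.reg 22 + σ.reg 1), σ.mem⟩) : next.Runs 1 Post σ :=
  runs_straight (by simp [Instr.IsPlain]) h

lemma keeps_update {b d : ℕ} (hb : b ≤ d) (hd : d < 32) (σ : Store) (x : ℝ) (m : ℕ → ℝ) :
    Keeps b σ ⟨Function.update σ.reg d x, m⟩ := fun r hr =>
  Function.update_of_ne (by omega) _ _

/-- Find a point with the largest distance to the first point. -/
def findFarthest : Block := whileLt 22 5 ((straight (fetch ++ distTo 28 7 8)).seq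
  ((ifLe 28 9 skip (straight [.move 9 28, .move 10 24, .move 11 25])).seq next))

/-- Registers `9`, `10`, `11` contain the point `q`, and the square of its distance to the first
point. -/
structure Farthest (z q : Plane) (σ : Store) : Prop where
  r9 : σ.reg 9 = dist q z ^ 2
  r10 : σ.reg 10 = q 0
  r11 : σ.reg 11 = q 1

lemma Farthest.of_eq {z q : Plane} {σ σ' : Store} (h : Farthest z q σ)
    (hk : ∀ r, r < 12 → σ'.reg r = σ.reg r) : Farthest z q σ' := by
  constructor
  · rw [hk _ (by norm_num)]; exact h.r9
  · rw [hk _ (by norm_num)]; exact h.r10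
  · rw [hk _ (by norm_num)]; exact h.r11

lemma Farthest.of_keeps {z q : Plane} {σ σ' : Store} (h : Farthest z q σ) {b : ℕ}
    (hk : Keeps b σ σ') (hb : 12 ≤ b) : Farthest z q σ' :=
  h.of_eq fun r hr => hk r (Or.inl (by omega))

/-- Register 9 starts at 0 and changes only for a strictly larger squared distance. As some point
differs from z, it ends positive, so a point has been recorded. -/
lemma runs_findFarthest {n : ℕ} {p : Fin n → Plane} {ε : ℝ} {z : Plane} {σ₀ : Store}
    (hS : Setup n ε z σ₀) (h9 : σ₀.reg 9 = 0) (h22 : σ₀.reg 22 = 0)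
    (hm : ∀ i : Fin n, HasPoint σ₀.mem i (p i)) (hne : ∃ i, p i ≠ z) :
    findFarthest.Runs (n * (10 + (3 + 2 + 1) + 2) + 1) (fun σ => Keeps 9 σ₀ σ ∧ σ.mem = σ₀.mem ∧
      ∃ j, p j ≠ z ∧ Farthest z (p j) σ ∧ ∀ i, dist (p i) z ≤ dist (p j) z) σ₀ := by
  let I : ℕ → Store → Prop := fun i σ => Keeps 9 σ₀ σ ∧ σ.mem = σ₀.mem ∧ σ.reg 22 = i ∧
    (∀ j : Fin n, j < i → dist (p j) z ^ 2 ≤ σ.reg 9) ∧ (σ.reg 9 = 0 ∨ ∃ j, Farthest z (p j) σ)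
  refine (runs_whileLt I ?_ ?_ ?_).mono le_rfl ?_
  · rintro i σ ⟨hk, -, hi, -⟩
    exact ⟨hi, (hk 5 (by norm_num)).trans hS.r5⟩
  · rintro i σ hin ⟨hk, hmem, hi, hle, hex⟩
    have hSσ := hS.of_keeps hk le_rfl
    refine Block.Runs.seq (runs_straight (by simp [fetch, distTo, Instr.IsPlain]) ?_)
    obtain ⟨e1, e2, e3, e4, e5⟩ := run_fetch_distTo hSσ hi (hmem ▸ hm ⟨i, hin⟩)
    set τ := run (fetch ++ distTo 28 7 8) σ
    have hSτ := hSσ.of_keeps e5 (by norm_num)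
    refine Block.Runs.seq (t := 5) (t' := 1) (runs_ifLe (t := 3) (fun hc => ?_) (fun hc => ?_))
    · refine runs_skip ?_
      refine runs_next ?_
      have k := keeps_update (b := 22) (d := 22) le_rfl (by norm_num) τ (τ.reg 22 + τ.reg 1) τ.mem
      have kσ : Keeps 22 σ ⟨Function.update τ.reg 22 (τ.reg 22 + τ.reg 1), τ.mem⟩ :=
        fun r hr => (k r hr).trans (e5 r (by omega))
      refine ⟨hk.trans kσ (by norm_num), e4.trans hmem, ?_, fun j hj => ?_, ?_⟩
      · simp [hSτ.r1, e5 22 (by norm_num), hi]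
      · rw [kσ 9 (by norm_num)]
        rcases Nat.lt_succ_iff_lt_or_eq.1 hj with h | h
        · exact hle j h
        · rw [← e5 9 (by norm_num), show j = ⟨i, hin⟩ from Fin.ext h, ← e3]; exact hc
      · rw [kσ 9 (by norm_num)]
        exact hex.imp_right fun ⟨j, hj⟩ => ⟨j, hj.of_keeps kσ (by norm_num)⟩
    · refine runs_straight (by simp [Instr.IsPlain]) ?_
      refine runs_next ?_
      simp only [run_cons, run_nil, act_move]
      have h9' : σ.reg 9 < dist (p ⟨i, hin⟩) z ^ 2 := by
        rw [← e3, ← e5 9 (by norm_num)]; exact hc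
      refine ⟨fun r hr => ?_, e4.trans hmem, ?_, fun j hj => ?_, Or.inr
        ⟨⟨i, hin⟩, ?_⟩⟩
      · simp only [Function.update_apply]
        simp [show r ≠ 22 by omega, show r ≠ 9 by omega, show r ≠ 10 by omega,
          show r ≠ 11 by omega, e5 r (by omega), hk r hr]
      · simp [hSτ.r1, e5 22 (by norm_num), hi]
      · have : dist (p j) z ^ 2 ≤ dist (p ⟨i, hin⟩) z ^ 2 := by
          rcases Nat.lt_succ_iff_lt_or_eq.1 hj with h | h
          · exact (hle j h).trans h9'.le
          · rw [show j = ⟨i, hin⟩ from Fin.ext h]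
        simpa [e3] using this
      · constructor <;> simp [e1, e2, e3]
  · exact ⟨Keeps.refl _ _, rfl, by simpa using h22,
      fun j hj => absurd hj (Nat.not_lt_zero _), Or.inl h9⟩
  · rintro σ ⟨hk, hmem, -, hle, hex⟩
    refine ⟨hk, hmem, ?_⟩
    have hpos : 0 < σ.reg 9 := by
      obtain ⟨i, hi⟩ := hne
      exact (pow_pos (dist_pos.2 hi) 2).trans_le (hle i i.2)
    obtain ⟨j, hj⟩ := hex.resolve_left hpos.ne'
    refine ⟨j, fun h => ?_, hj, fun i => ?_⟩
    · rw [hj.r9, h, dist_self] at hpos; norm_num at hpos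
    · have := hle i i.2
      rw [hj.r9] at this
      exact le_of_sq_le_sq this dist_nonneg

/-- Lets the machine compare distances through their squares, without square roots. -/
lemma sq_mul_le_sq_iff {d R : ℝ} (hd : 0 ≤ d) (hR : 0 ≤ R) :
    d ^ 2 * 256 ≤ R ^ 2 ↔ d ≤ R / 16 := by
  rw [show d ^ 2 * 256 = (d * 16) ^ 2 by ring, sq_le_sq₀ (by positivity) hR,
    le_div_iff₀ (by norm_num)]

/-- Set register `12` to `1` if there is a point that is neither close to the first point nor close
to the farthest point, and the accuracy is less than `128`; otherwise set it to `0`. -/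
def detectSpread : Block := (straight [.const 22 0, .const 12 0]).seq
  ((whileLt 22 5 ((straight (fetch ++ distTo 28 7 8 ++
      (distTo 29 10 11 ++ [.mul 28 28 3, .mul 29 29 3]))).seq
    ((ifLe 28 9 skip (ifLe 29 9 skip (straight [.const 12 1]))).seq next))).seq
  (ifLe 4 6 (straight [.const 12 0]) skip))

lemma runs_detectSpread {n : ℕ} {p : Fin n → Plane} {ε : ℝ} {z q : Plane} {σ₀ : Store}
    (hS : Setup n ε z σ₀) (hq : Farthest z q σ₀) (hm : ∀ i : Fin n, HasPoint σ₀.mem i (p i)) :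
    detectSpread.Runs (2 + (n * (17 + (5 + 1) + 2) + 1 + 3)) (fun σ => Keeps 12 σ₀ σ ∧
      σ.mem = σ₀.mem ∧
      ((σ.reg 12 = 0 ∧ (128 ≤ ε ∨ ∀ i, dist (p i) z ≤ dist q z / 16 ∨
          dist (p i) q ≤ dist q z / 16)) ∨
        (σ.reg 12 = 1 ∧ ε < 128 ∧ ∃ i, dist q z / 16 ≤ dist (p i) z ∧
          dist q z / 16 ≤ dist (p i) q))) σ₀ := by
  refine Block.Runs.seq (runs_straight (by simp [Instr.IsPlain]) ?_)
  let I : ℕ → Store → Prop := fun i σ => Keeps 12 σ₀ σ ∧ σ.mem = σ₀.mem ∧ σ.reg 22 = i ∧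
    ((σ.reg 12 = 0 ∧ ∀ j : Fin n, j < i → dist (p j) z ≤ dist q z / 16 ∨
          dist (p j) q ≤ dist q z / 16) ∨
      (σ.reg 12 = 1 ∧ ∃ i, dist q z / 16 ≤ dist (p i) z ∧ dist q z / 16 ≤ dist (p i) q))
  refine Block.Runs.seq ((runs_whileLt I ?_ ?_ ?_).mono le_rfl ?_)
  · rintro i σ ⟨hk, -, hi, -⟩
    exact ⟨hi, (hk 5 (by norm_num)).trans hS.r5⟩
  · rintro i σ hin ⟨hk, hmem, hi, hex⟩
    have hSσ := hS.of_keeps hk (by norm_num)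
    have hqσ := hq.of_keeps hk le_rfl
    refine Block.Runs.seq (runs_straight (by simp [fetch, distTo, Instr.IsPlain]) ?_)
    obtain ⟨e1, e2, e3, e4, e5⟩ := run_fetch_distTo hSσ hi (hmem ▸ hm ⟨i, hin⟩)
    rw [run_append]
    set τ := run (fetch ++ distTo 28 7 8) σ
    have hqτ := hqσ.of_keeps e5 (by norm_num)
    obtain ⟨f1, f2⟩ := run_distTo (d := 29) e1 e2 hqτ.r10 hqτ.r11 (by norm_num)
    have f3 := keeps_distTo (d := 29) (by norm_num) 10 11 τ
    have f4 : (run (distTo 29 10 11) τ).reg 28 = dist (p ⟨i, hin⟩) z ^ 2 := by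
      rw [← e3]; simp [distTo]
    rw [run_append]
    have hk' := e5.trans f3 (by norm_num)
    set υ := run (distTo 29 10 11) τ
    have hSυ := hSσ.of_keeps hk' (by norm_num)
    have hqυ := hqσ.of_keeps hk' (by norm_num)
    have g : run [.mul 28 28 3, .mul 29 29 3] υ = ⟨Function.update (Function.update υ.reg 28
        (dist (p ⟨i, hin⟩) z ^ 2 * 256)) 29 (dist (p ⟨i, hin⟩) q ^ 2 * 256), υ.mem⟩ := by
      simp [f1, f4, hSυ.r3]
    rw [g]
    have hυ : υ.mem = σ₀.mem := (f2.trans e4).trans hmem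
    have hυ22 : υ.reg 22 = i := (hk' 22 (by norm_num)).trans hi
    have hυ12 : υ.reg 12 = σ.reg 12 := hk' 12 (by norm_num)
    have hkυ : Keeps 12 σ₀ υ := hk.trans hk' (by norm_num)
    have key := fun i => sq_mul_le_sq_iff (d := dist (p i) z) (R := dist q z) dist_nonneg
      dist_nonneg
    have key' := fun i => sq_mul_le_sq_iff (d := dist (p i) q) (R := dist q z) dist_nonneg
      dist_nonneg
    -- Both tests for closeness lead to the same store, so the invariant is verified once for both
    -- branches.
    have close : (dist (p ⟨i, hin⟩) z ≤ dist q z / 16 ∨ dist (p ⟨i, hin⟩) q ≤ dist q z / 16) →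
        I (i + 1) ⟨Function.update (Function.update (Function.update υ.reg 28
          (dist (p ⟨i, hin⟩) z ^ 2 * 256)) 29 (dist (p ⟨i, hin⟩) q ^ 2 * 256)) 22 (i + 1),
          υ.mem⟩ := fun hc => by
      refine ⟨fun r hr => ?_, hυ, by simp, ?_⟩
      · simp only [Function.update_apply]
        simp [show r ≠ 22 by omega, show r ≠ 28 by omega, show r ≠ 29 by omega, hkυ r hr]
      · simp only [Function.update_apply]
        simp only [hυ12, Nat.reduceEqDiff, if_false]
        refine hex.imp_left (And.imp_right fun h j hj => ?_)
        rcases Nat.lt_succ_iff_lt_or_eq.1 hj with hj | hj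
        · exact h j hj
        · rwa [show j = ⟨i, hin⟩ from Fin.ext hj]
    refine Block.Runs.seq (t := 5) (t' := 1) (runs_ifLe (t := 3) (fun hc => ?_) (fun hc => ?_))
    · refine runs_skip (runs_next ?_)
      simp only [Function.update_apply] at hc
      simp [hqυ.r9] at hc
      have := close (Or.inl ((key _).1 hc))
      simpa [hυ22, hSυ.r1] using this
    · refine runs_ifLe (t := 1) (fun hc' => ?_) (fun hc' => ?_)
      · refine runs_skip (runs_next ?_)
        simp only [Function.update_apply] at hc'
        simp [hqυ.r9] at hc'
        have := close (Or.inr ((key' _).1 hc'))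
        simpa [hυ22, hSυ.r1] using this
      · refine runs_straight (by simp [Instr.IsPlain]) (runs_next ?_)
        simp only [Function.update_apply] at hc hc'
        simp [hqυ.r9] at hc hc'
        refine ⟨fun r hr => ?_, hυ, ?_, Or.inr ⟨by simp, ⟨i, hin⟩, ?_, ?_⟩⟩
        · simp only [run_cons, run_nil, act_const, Function.update_apply]
          simp [show r ≠ 22 by omega, show r ≠ 28 by omega, show r ≠ 29 by omega,
            show r ≠ 12 by omega, hkυ r hr]
        · simp [hυ22, hSυ.r1]
        · by_contra hcon
          exact absurd ((key _).2 (not_le.1 hcon).le) (not_le.2 hc)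
        · by_contra hcon
          exact absurd ((key' _).2 (not_le.1 hcon).le) (not_le.2 hc')
  · refine ⟨fun r hr => ?_, rfl, by simp,
      Or.inl ⟨by simp, fun j hj => absurd hj (Nat.not_lt_zero _)⟩⟩
    simp only [run_cons, run_nil, act_const, Function.update_apply]
    simp [show r ≠ 22 by omega, show r ≠ 12 by omega]
  · rintro σ ⟨hk, hmem, -, hex⟩
    have hSσ := hS.of_keeps hk (by norm_num)
    refine runs_ifLe (t := 1) (fun hc => ?_) (fun hc => ?_)
    · rw [hSσ.r4, hSσ.r6] at hc
      exact runs_straight (by simp [Instr.IsPlain])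
        ⟨hk.trans (keeps_update le_rfl (by norm_num) _ _ _) le_rfl, hmem,
          Or.inl ⟨by simp, Or.inl hc⟩⟩
    · rw [hSσ.r4, hSσ.r6] at hc
      exact runs_skip ⟨hk, hmem, hex.imp (And.imp_right fun h => Or.inr fun i => h i i.2)
        (And.imp_right fun h => ⟨hc, h⟩)⟩

/-- A loop that writes the labels which `b` computes in register `31`. -/
def writeLabels (b : Block) : Block := (straight [.const 22 0]).seq
  (whileLt 22 5 (b.seq (straight [.store 22 31, .add 22 22 1])))

/-- The labels overwrite the input. This is safe because iteration i has changed only cells below i,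
whereas point i is stored in cells 2i + 2 and 2i + 3. -/
lemma runs_writeLabels {n t : ℕ} {lab : Fin n → ℝ} {b : Block} {σ₀ : Store}
    (h1 : σ₀.reg 1 = 1) (h5 : σ₀.reg 5 = n)
    (hb : ∀ (i : Fin n) (σ : Store), Keeps 22 σ₀ σ → σ.reg 22 = (i : ℕ) →
      (∀ j : ℕ, i ≤ j → σ.mem j = σ₀.mem j) →
      b.Runs t (fun σ' => Keeps 23 σ σ' ∧ σ'.mem = σ.mem ∧ σ'.reg 31 = lab i) σ) :
    (writeLabels b).Runs (1 + (n * (t + 2 + 2) + 1))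
      (fun σ => ∀ i : Fin n, σ.mem i = lab i) σ₀ := by
  refine Block.Runs.seq (runs_straight (by simp [Instr.IsPlain]) ?_)
  let I : ℕ → Store → Prop := fun i σ => Keeps 22 σ₀ σ ∧ σ.reg 22 = i ∧
    (∀ j, i ≤ j → σ.mem j = σ₀.mem j) ∧ ∀ j : Fin n, j < i → σ.mem j = lab j
  refine (runs_whileLt I ?_ ?_ ?_).mono le_rfl fun σ h i => h.2.2.2 i i.2
  · rintro i σ ⟨hk, hi, -⟩
    exact ⟨hi, (hk 5 (by norm_num)).trans h5⟩
  · rintro i σ hin ⟨hk, hi, hge, hlt⟩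
    refine Block.Runs.seq ((hb ⟨i, hin⟩ σ hk hi hge).mono le_rfl ?_)
    rintro τ ⟨hk', hmem, h31⟩
    have h22 : τ.reg 22 = i := (hk' 22 (by norm_num)).trans hi
    have hτ1 : τ.reg 1 = 1 := ((hk' 1 (by norm_num)).trans (hk 1 (by norm_num))).trans h1
    refine runs_straight (by simp [Instr.IsPlain]) ?_
    simp only [run_cons, run_nil, act_store, act_add, h22, h31, hτ1, Nat.floor_natCast, hmem]
    refine ⟨fun r hr => ?_, by simp, fun j hj => ?_, fun j hj => ?_⟩
    · simp only [Function.update_apply]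
      simp [show r ≠ 22 by omega, hk' r (by omega), hk r hr]
    · simp only [Function.update_apply]
      simp [show j ≠ i by omega, hge j (by omega)]
    · simp only [Function.update_apply]
      rcases Nat.lt_succ_iff_lt_or_eq.1 hj with hj | hj
      · simp [hj.ne, hlt j hj]
      · simp [show j = ⟨i, hin⟩ from Fin.ext hj]
  · refine ⟨keeps_update le_rfl (by norm_num) _ _ _, by simp, fun _ _ => rfl,
      fun j hj => absurd hj (Nat.not_lt_zero _)⟩

/-- Separate the points that are close to the first point from the others. -/
def separateClose : Block := writeLabels ((straight (fetch ++ distTo 28 7 8 ++ [.mul 28 28 3])).seq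
  (ifLe 28 9 (straight [.const 31 1]) (straight [.const 31 0])))

open Classical in
lemma runs_separateClose {n : ℕ} {p : Fin n → Plane} {ε : ℝ} {z q : Plane} {σ₀ : Store}
    (hS : Setup n ε z σ₀) (hq : Farthest z q σ₀) (hm : ∀ i : Fin n, HasPoint σ₀.mem i (p i)) :
    separateClose.Runs (1 + (n * (14 + 2 + 2) + 1))
      (fun σ => Outputs σ.mem fun i => decide (dist (p i) z ≤ dist q z / 16)) σ₀ := by
  refine (runs_writeLabels (lab := fun i => if dist (p i) z ≤ dist q z / 16 then 1 else 0)
    hS.r1 hS.r5 ?_).mono le_rfl fun σ h i => by simpa using h i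
  intro i σ hk hi hge
  have hSσ := hS.of_keeps hk (by norm_num)
  have hqσ := hq.of_keeps hk (by norm_num)
  have hpt : HasPoint σ.mem i (p i) :=
    ⟨(hge _ (by omega)).trans (hm i).1, (hge _ (by omega)).trans (hm i).2⟩
  obtain ⟨e1, e2, e3, e4, e5⟩ := run_fetch_distTo hSσ hi hpt
  refine Block.Runs.seq (t := 11) (t' := 3)
    (runs_straight (by simp [fetch, distTo, Instr.IsPlain]) ?_)
  rw [run_append]
  set τ := run (fetch ++ distTo 28 7 8) σ
  have hSτ := hSσ.of_keeps e5 (by norm_num)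
  have hqτ := hqσ.of_keeps e5 (by norm_num)
  have key := sq_mul_le_sq_iff (d := dist (p i) z) (R := dist q z) dist_nonneg dist_nonneg
  simp only [run_cons, run_nil, act_mul, e3, hSτ.r3]
  have hk' : ∀ x y : ℝ, Keeps 23 σ ⟨Function.update (Function.update τ.reg 28 x) 31 y, τ.mem⟩ :=
    fun x y r hr => by
      simp only [Function.update_apply]
      simp [show r ≠ 28 by omega, show r ≠ 31 by omega, e5 r hr]
  refine runs_ifLe (t := 1) (fun hc => ?_) (fun hc => ?_)
  · simp [hqτ.r9, key] at hc
    exact runs_straight (by simp [Instr.IsPlain]) ⟨hk' _ _, e4, by simp [hc]⟩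
  · simp only [Function.update_self, hqτ.r9, Function.update_apply] at hc
    simp at hc
    rw [← not_le, key, not_le] at hc
    exact runs_straight (by simp [Instr.IsPlain]) ⟨hk' _ _, e4, by simp [hc]⟩

/-! ### The grid -/

/-- The number of the grid cell of the point `s`: the grid has cells of side length `1 / S`, and
`2 N + 1` rows and columns around the point `z`. -/
def cell (z : Plane) (N : ℕ) (S : ℝ) (s : Plane) : ℕ :=
  ((⌊(s 0 - z 0) * S⌋ + N) * (2 * N + 1) + (⌊(s 1 - z 1) * S⌋ + N)).toNat

lemma abs_coord_sub_le_dist (s t : Plane) (i : Fin 2) : |s i - t i| ≤ dist s t := by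
  have := PiLp.norm_apply_le (p := 2) (s - t) i
  rwa [← dist_eq_norm, PiLp.sub_apply, Real.norm_eq_abs] at this

lemma floor_coord_bounds {z s : Plane} {N : ℕ} {S : ℝ} (hS : 0 ≤ S) (h : dist s z * S ≤ N)
    (i : Fin 2) : -(N : ℤ) ≤ ⌊(s i - z i) * S⌋ ∧ ⌊(s i - z i) * S⌋ ≤ N := by
  have h1 := abs_le.1 ((abs_coord_sub_le_dist s z i))
  have h2 := mul_le_mul_of_nonneg_right h1.1 hS
  have h3 := mul_le_mul_of_nonneg_right h1.2 hS
  constructor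
  · rw [Int.le_floor]; push_cast; linarith
  · have : (⌊(s i - z i) * S⌋ : ℝ) ≤ N := (Int.floor_le _).trans (h3.trans h)
    exact_mod_cast this

lemma cell_cast {z s : Plane} {N : ℕ} {S : ℝ} (hS : 0 ≤ S) (h : dist s z * S ≤ N) :
    (cell z N S s : ℤ)
      = (⌊(s 0 - z 0) * S⌋ + N) * (2 * N + 1) + (⌊(s 1 - z 1) * S⌋ + N) := by
  have h0 := floor_coord_bounds hS h 0
  have h1 := floor_coord_bounds hS h 1
  refine Int.toNat_of_nonneg (add_nonneg (mul_nonneg ?_ ?_) ?_) <;> omega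

lemma cell_lt {z s : Plane} {N : ℕ} {S : ℝ} (hS : 0 ≤ S) (h : dist s z * S ≤ N) :
    cell z N S s < (2 * N + 1) ^ 2 := by
  have h0 := floor_coord_bounds hS h 0
  have h1 := floor_coord_bounds hS h 1
  have : (cell z N S s : ℤ) < (2 * N + 1) ^ 2 := by
    rw [cell_cast hS h]
    nlinarith
  exact_mod_cast this

/-- Equal cell numbers have equal row and column, so both scaled coordinates differ by less than 1
and the scaled distance is below √2; the bound 2 suffices. -/
lemma dist_mul_le_of_cell_eq {z s t : Plane} {N : ℕ} {S : ℝ} (hS : 0 ≤ S)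
    (hs : dist s z * S ≤ N) (ht : dist t z * S ≤ N) (h : cell z N S s = cell z N S t) :
    dist s t * S ≤ 2 := by
  have e : (cell z N S s : ℤ) = cell z N S t := by rw [h]
  rw [cell_cast hS hs, cell_cast hS ht] at e
  have s1 := floor_coord_bounds hS hs 1
  have t1 := floor_coord_bounds hS ht 1
  -- The second digit lies in 0, …, 2N, so it cannot compensate a change of the first digit, which
  -- is worth at least 2N + 1.
  have e0 : ⌊(s 0 - z 0) * S⌋ = ⌊(t 0 - z 0) * S⌋ := by
    rcases lt_trichotomy ⌊(s 0 - z 0) * S⌋ ⌊(t 0 - z 0) * S⌋ with hlt | heq | hlt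
    · nlinarith
    · exact heq
    · nlinarith
  have e1 : ⌊(s 1 - z 1) * S⌋ = ⌊(t 1 - z 1) * S⌋ := by rw [e0] at e; linarith
  have b0 := abs_lt.1 (Int.abs_sub_lt_one_of_floor_eq_floor e0)
  have b1 := abs_lt.1 (Int.abs_sub_lt_one_of_floor_eq_floor e1)
  refine le_of_sq_le_sq ?_ (by norm_num)
  rw [mul_pow, dist_sq_eq]
  nlinarith

/-- The part of the register contents that describes a grid with `2 N + 1` rows and columns, whose
cells have the side length `1 / S`: the table of the cells is followed by the memory of the
program to be called. -/
structure Grid (n N : ℕ) (S : ℝ) (σ : Store) : Prop where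
  r15 : σ.reg 15 = S
  r16 : σ.reg 16 = 2 * N + 1
  r18 : σ.reg 18 = N * (2 * N + 1) + N + (2 * n + 2)
  r19 : σ.reg 19 = ((2 * n + 2 + (2 * N + 1) ^ 2 : ℕ) : ℝ)

lemma Grid.of_eq {n N : ℕ} {S : ℝ} {σ σ' : Store} (h : Grid n N S σ)
    (hk : ∀ r, r < 20 → σ'.reg r = σ.reg r) : Grid n N S σ' := by
  constructor
  · rw [hk _ (by norm_num)]; exact h.r15
  · rw [hk _ (by norm_num)]; exact h.r16
  · rw [hk _ (by norm_num)]; exact h.r18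
  · rw [hk _ (by norm_num)]; exact h.r19

lemma Grid.of_keeps {n N : ℕ} {S : ℝ} {σ σ' : Store} (h : Grid n N S σ) {b : ℕ}
    (hk : Keeps b σ σ') (hb : 20 ≤ b) : Grid n N S σ' :=
  h.of_eq fun r hr => hk r (Or.inl (by omega))

/-- Load a point, put the address of the table entry of its cell into register `30` and the entry
into register `31`. -/
def locate : List Instr := fetch ++
  [.sub 26 24 7, .mul 26 26 15, .floor 26 26, .sub 27 25 8, .mul 27 27 15, .floor 27 27,
    .mul 26 26 16, .add 30 26 27, .add 30 30 18, .load 31 30]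

lemma run_locate {n N : ℕ} {ε S : ℝ} {z s : Plane} {σ : Store} (hσ : Setup n ε z σ)
    (hG : Grid n N S σ) (hS : 0 ≤ S) (hs : dist s z * S ≤ N) {i : ℕ} (hi : σ.reg 22 = i)
    (hpt : HasPoint σ.mem i s) :
    (run locate σ).reg 24 = s 0 ∧ (run locate σ).reg 25 = s 1 ∧
    (run locate σ).reg 30 = ((2 * n + 2 + cell z N S s : ℕ) : ℝ) ∧
    (run locate σ).reg 31 = σ.mem (2 * n + 2 + cell z N S s) ∧
    (run locate σ).mem = σ.mem ∧ Keeps 23 σ (run locate σ) := by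
  obtain ⟨e1, e2, e3⟩ := run_fetch hσ hi hpt
  have hk := keeps_fetch σ
  have hσ' := hσ.of_keeps hk (by norm_num)
  have hG' := hG.of_keeps hk (by norm_num)
  have hc : (⌊(s 0 - z 0) * S⌋ : ℝ) * (2 * N + 1) + ⌊(s 1 - z 1) * S⌋
      + (N * (2 * N + 1) + N + (2 * n + 2)) = ((2 * n + 2 + cell z N S s : ℕ) : ℝ) := by
    have : (cell z N S s : ℝ)
        = (⌊(s 0 - z 0) * S⌋ + N) * (2 * N + 1) + (⌊(s 1 - z 1) * S⌋ + N) := by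
      exact_mod_cast congrArg (Int.cast : ℤ → ℝ) (cell_cast hS hs)
    push_cast
    rw [this]; ring
  have hk2 : Keeps 23 σ (run locate σ) := keeps_run (by simp [locate, fetch, Instr.WritesFrom]) σ
  refine ⟨?_, ?_, ?_, ?_, ?_, hk2⟩
  all_goals
    rw [locate, run_append]
    simp [e1, e2, e3, hσ'.r7, hσ'.r8, hG'.r15, hG'.r16, hG'.r18, hc, -Nat.cast_add]

/-! ### The table of the cells -/

/-- The memory `m` after `i` points have been treated: the points `p (f a)` with `a < k` represent
the non-empty cells. The table of the cells ends before the address `B`, and from `B + 1` on the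
memory contains the coordinates of the representatives. -/
structure Table {n : ℕ} (p : Fin n → Plane) (key : Fin n → ℕ) (B i k : ℕ) (f : ℕ → Fin n)
    (m₀ m : ℕ → ℝ) : Prop where
  -- Indices are stored increased by one, so that 0, the initial memory content, marks an empty
  -- cell.
  entry : ∀ a, a < k → m (2 * n + 2 + key (f a)) = a + 1
  found : ∀ j : Fin n, j < i → ∃ a < k, key (f a) = key j
  absent : ∀ c, 2 * n + 2 ≤ c → c < B → (∀ a < k, c ≠ 2 * n + 2 + key (f a)) → m c = 0
  point : ∀ a, a < k → m (B + 1 + 2 * a) = p (f a) 0 ∧ m (B + 2 + 2 * a) = p (f a) 1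
  rest : ∀ c, B + 1 + 2 * k ≤ c → m c = 0
  -- This cell is reserved for the number of representatives, known only after the loop.
  size : m B = 0
  input : ∀ c, c < 2 * n + 2 → m c = m₀ c

lemma Table.skip {n : ℕ} {p : Fin n → Plane} {key : Fin n → ℕ} {B k : ℕ} {i : Fin n}
    {f : ℕ → Fin n} {m₀ m : ℕ → ℝ} (h : Table p key B i k f m₀ m)
    (hi : ∃ a < k, key (f a) = key i) : Table p key B (i + 1) k f m₀ m :=
  { h with
    found := fun j hj => by
      rcases Nat.lt_succ_iff_lt_or_eq.1 hj with hj | hj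
      · exact h.found j hj
      · rwa [Fin.ext hj] }

lemma Table.insert {n : ℕ} {p : Fin n → Plane} {key : Fin n → ℕ} {B k : ℕ} {i : Fin n}
    {f : ℕ → Fin n} {m₀ m : ℕ → ℝ} (h : Table p key B i k f m₀ m)
    (hB : ∀ j, 2 * n + 2 + key j < B) (hi : ∀ a < k, key (f a) ≠ key i) :
    Table p key B (i + 1) (k + 1) (Function.update f k i) m₀
      (Function.update (Function.update (Function.update m (2 * n + 2 + key i) (k + 1))
        (B + 1 + 2 * k) (p i 0)) (B + 2 + 2 * k) (p i 1)) := by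
  have hf : ∀ a, a < k → Function.update f k i a = f a := fun a ha =>
    Function.update_of_ne ha.ne _ _
  have hfk : Function.update f k i k = i := Function.update_self _ _ _
  have low : ∀ c, c < B + 1 + 2 * k → (Function.update (Function.update (Function.update m
      (2 * n + 2 + key i) (k + 1 : ℝ)) (B + 1 + 2 * k) (p i 0)) (B + 2 + 2 * k) (p i 1)) c
      = Function.update m (2 * n + 2 + key i) (k + 1 : ℝ) c := fun c hc => by
    rw [Function.update_of_ne (by omega), Function.update_of_ne (by omega)]
  have hBi := hB i
  constructor
  · intro a ha
    rcases Nat.lt_succ_iff_lt_or_eq.1 ha with ha | rfl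
    · have := hB (f a)
      have hne := hi a ha
      rw [hf a ha, low _ (by omega), Function.update_of_ne (by omega), h.entry a ha]
    · rw [hfk, low _ (by omega), Function.update_self]
  · intro j hj
    rcases Nat.lt_succ_iff_lt_or_eq.1 hj with hj | hj
    · obtain ⟨a, ha, e⟩ := h.found j hj
      exact ⟨a, ha.trans (Nat.lt_succ_self k), by rw [hf a ha, e]⟩
    · exact ⟨k, Nat.lt_succ_self k, by rw [hfk, Fin.ext hj]⟩
  · intro c hc hcB hne
    have h1 := hne k (Nat.lt_succ_self k)
    rw [hfk] at h1
    rw [low _ (by omega), Function.update_of_ne h1]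
    exact h.absent c hc hcB fun a ha => by
      rw [← hf a ha]; exact hne a (ha.trans (Nat.lt_succ_self k))
  · intro a ha
    rcases Nat.lt_succ_iff_lt_or_eq.1 ha with ha | rfl
    · rw [hf a ha, low _ (by omega), low _ (by omega), Function.update_of_ne (by omega),
        Function.update_of_ne (by omega)]
      exact h.point a ha
    · rw [hfk, Function.update_self, Function.update_of_ne (by omega), Function.update_self]
      exact ⟨rfl, rfl⟩
  · intro c hc
    rw [Function.update_of_ne (by omega), Function.update_of_ne (by omega),
      Function.update_of_ne (by omega)]
    exact h.rest c (by omega)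
  · rw [low _ (by omega), Function.update_of_ne (by omega)]
    exact h.size
  · intro c hc
    rw [low _ (by omega), Function.update_of_ne (by omega)]
    exact h.input c hc

/-- The table entry of a cell determines the index of its representative. -/
lemma Table.key_injective {n : ℕ} {p : Fin n → Plane} {key : Fin n → ℕ} {B i k : ℕ}
    {f : ℕ → Fin n} {m₀ m : ℕ → ℝ} (h : Table p key B i k f m₀ m) {a b : ℕ} (ha : a < k)
    (hb : b < k) (hab : key (f a) = key (f b)) : a = b := by
  have h1 := h.entry a ha
  rw [hab, h.entry b hb] at h1
  have h2 : (b : ℝ) = a := by linarith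
  exact_mod_cast h2.symm

/-- Put one point of every non-empty cell into the input of the program to be called. -/
def buildTable : Block := whileLt 22 5 ((straight locate).seq ((ifLe 31 0 (straight
  [.add 21 21 1, .store 30 21, .store 20 24, .add 20 20 1, .store 20 25, .add 20 20 1]) skip).seq
    next))

/-- The table has (2N + 1)² cells, yet the time is linear in n: memory beyond the input is zero, so
no cell has to be initialized. -/
lemma runs_buildTable {n N : ℕ} {p : Fin n → Plane} {ε S : ℝ} {z : Plane} {σ₀ : Store}
    (hσ : Setup n ε z σ₀) (hG : Grid n N S σ₀) (hS : 0 ≤ S) (hp : ∀ i, dist (p i) z * S ≤ N)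
    (hm : ∀ i : Fin n, HasPoint σ₀.mem i (p i)) (hz : ∀ c, 2 * n + 2 ≤ c → σ₀.mem c = 0)
    (h20 : σ₀.reg 20 = ((2 * n + 2 + (2 * N + 1) ^ 2 + 1 : ℕ) : ℝ)) (h21 : σ₀.reg 21 = 0)
    (h22 : σ₀.reg 22 = 0) (hn : 0 < n) :
    buildTable.Runs (n * (15 + (8 + 1) + 2) + 1) (fun σ => Keeps 20 σ₀ σ ∧
      ∃ (k : ℕ) (f : ℕ → Fin n), σ.reg 21 = k ∧
      Table p (fun i => cell z N S (p i)) (2 * n + 2 + (2 * N + 1) ^ 2) n k f σ₀.mem σ.mem)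
      σ₀ := by
  set B := 2 * n + 2 + (2 * N + 1) ^ 2 with hBdef
  set key : Fin n → ℕ := fun i => cell z N S (p i) with hkey
  have hB : ∀ j, 2 * n + 2 + key j < B := fun j => by
    have := cell_lt hS (hp j); simp only [hkey, hBdef]; omega
  let I : ℕ → Store → Prop := fun i σ => Keeps 20 σ₀ σ ∧ σ.reg 22 = i ∧ ∃ (k : ℕ) (f : ℕ → Fin n),
    σ.reg 21 = k ∧ σ.reg 20 = ((B + 1 + 2 * k : ℕ) : ℝ) ∧ Table p key B i k f σ₀.mem σ.mem
  refine (runs_whileLt I ?_ ?_ ?_).mono le_rfl ?_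
  · rintro i σ ⟨hk, hi, -⟩
    exact ⟨hi, (hk 5 (by norm_num)).trans hσ.r5⟩
  · rintro i σ hin ⟨hk, hi, k, f, hk21, hk20, hT⟩
    have hpt : HasPoint σ.mem i (p ⟨i, hin⟩) :=
      ⟨(hT.input _ (by omega)).trans (hm ⟨i, hin⟩).1, (hT.input _ (by omega)).trans (hm ⟨i, hin⟩).2⟩
    obtain ⟨e1, e2, e3, e4, e5, e6⟩ :=
      run_locate (hσ.of_keeps hk (by norm_num)) (hG.of_keeps hk le_rfl) hS (hp ⟨i, hin⟩) hi hpt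
    refine Block.Runs.seq (runs_straight (by simp [locate, fetch, Instr.IsPlain]) ?_)
    set τ := run locate σ
    have hστ := (hσ.of_keeps hk (by norm_num)).of_keeps e6 (by norm_num)
    have t20 := (e6 20 (by norm_num)).trans hk20
    have t21 := (e6 21 (by norm_num)).trans hk21
    have t22 := (e6 22 (by norm_num)).trans hi
    refine Block.Runs.seq (t := 8) (t' := 1) (runs_ifLe (t := 6) (fun hc => ?_) (fun hc => ?_))
    -- An occupied cell would hold a + 1 > 0.
    · have hnew : ∀ a < k, key (f a) ≠ key ⟨i, hin⟩ := fun a ha hE => by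
        have := hT.entry a ha
        rw [hE] at this
        rw [e4, hστ.r0] at hc
        have h3 : σ.mem (2 * n + 2 + cell z N S (p ⟨i, hin⟩)) = a + 1 := this
        rw [h3] at hc
        have : (0 : ℝ) ≤ a := Nat.cast_nonneg a
        linarith
      have hins := Table.insert (i := ⟨i, hin⟩) hT hB hnew
      refine runs_straight (by simp [Instr.IsPlain]) (runs_next ?_)
      have c1 : ⌊((B + 1 + 2 * k : ℕ) : ℝ) + 1⌋₊ = B + 2 + 2 * k := by
        rw [← Nat.cast_add_one, Nat.floor_natCast]; ring
      have c2 : ⌊((2 * n + 2 + cell z N S (p ⟨i, hin⟩) : ℕ) : ℝ)⌋₊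
        = 2 * n + 2 + key ⟨i, hin⟩ := Nat.floor_natCast _
      have c3 : ⌊((B + 1 + 2 * k : ℕ) : ℝ)⌋₊ = B + 1 + 2 * k := Nat.floor_natCast _
      have hmem : (run [.add 21 21 1, .store 30 21, .store 20 24, .add 20 20 1, .store 20 25,
          .add 20 20 1] τ).mem = Function.update (Function.update (Function.update σ.mem
          (2 * n + 2 + key ⟨i, hin⟩) (k + 1)) (B + 1 + 2 * k) (p ⟨i, hin⟩ 0))
          (B + 2 + 2 * k) (p ⟨i, hin⟩ 1) := by
        simp only [run_cons, run_nil, act_add, act_store, Function.update_apply τ.reg,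
          Nat.reduceEqDiff, if_false, if_true, Function.update_apply (Function.update τ.reg _ _),
          t20, t21, hστ.r1, e1, e2, e3, e5, c1, c2, c3]
      refine ⟨fun r hr => ?_, ?_, k + 1, Function.update f k ⟨i, hin⟩, ?_, ?_, ?_⟩
      · simp only [run_cons, run_nil, act_add, act_store, Function.update_apply]
        simp [show r ≠ 22 by omega, show r ≠ 20 by omega, show r ≠ 21 by omega, e6 r (by omega),
          hk r hr]
      · simp [t22, hστ.r1]
      · simp [t21, hστ.r1]
      · simp [t20, hστ.r1]; ring
      · rw [hmem]; exact hins
    · have hold : ∃ a < k, key (f a) = key ⟨i, hin⟩ := by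
        by_contra hcon
        push Not at hcon
        rw [e4, hστ.r0, hT.absent _ (by omega) (hB ⟨i, hin⟩) fun a ha hE =>
          hcon a ha (by simp only [hkey] at hE ⊢; omega)] at hc
        exact lt_irrefl _ hc
      have kτ : Keeps 22 σ ⟨Function.update τ.reg 22 (τ.reg 22 + τ.reg 1), τ.mem⟩ := fun r hr =>
        (keeps_update (b := 22) le_rfl (by norm_num) τ _ τ.mem r hr).trans (e6 r (by omega))
      refine runs_skip (runs_next ⟨hk.trans kτ (by norm_num), ?_, k, f, ?_, ?_, ?_⟩)
      · simp [t22, hστ.r1]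
      · rw [kτ 21 (by norm_num), hk21]
      · rw [kτ 20 (by norm_num), hk20]
      · simp only [e5]; exact Table.skip (i := ⟨i, hin⟩) hT hold
  · refine ⟨Keeps.refl _ _, by simpa using h22, 0, fun _ => ⟨0, hn⟩, by simpa using h21,
      by simpa using h20, ?_⟩
    exact
    { entry := fun a ha => absurd ha (Nat.not_lt_zero _)
      found := fun j hj => absurd hj (Nat.not_lt_zero _)
      absent := fun c hc _ _ => hz c hc
      point := fun a ha => absurd ha (Nat.not_lt_zero _)
      rest := fun c hc => hz c (by omega)
      size := hz B (by omega)
      input := fun c _ => rfl }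
  · rintro σ ⟨hk, -, k, f, h1, -, hT⟩
    exact ⟨hk, k, f, h1, hT⟩

/-! ### Rounding and solving the rounded instance -/

/-- Compute the parameters of the grid from the accuracy and the largest distance. -/
def prepareGrid : List Instr :=
  [.sqrt 13 9, .div 14 3 6, .floor 14 14, .add 14 14 1, .div 15 14 13, .add 16 14 14, .add 16 16 1,
    .add 17 5 5, .add 17 17 2, .mul 18 14 16, .add 18 18 14, .add 18 18 17, .mul 19 16 16,
    .add 19 19 17, .add 20 19 1, .const 21 0, .const 22 0]

lemma run_prepareGrid {n : ℕ} {ε : ℝ} {z q : Plane} {σ : Store} (hσ : Setup n ε z σ)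
    (hq : Farthest z q σ) (hε : 0 < ε) {N : ℕ} (hN : N = ⌊256 / ε⌋₊ + 1) :
    Grid n N (N / dist q z) (run prepareGrid σ) ∧
    (run prepareGrid σ).reg 20 = ((2 * n + 2 + (2 * N + 1) ^ 2 + 1 : ℕ) : ℝ) ∧
    (run prepareGrid σ).reg 21 = 0 ∧ (run prepareGrid σ).reg 22 = 0 ∧
    (run prepareGrid σ).mem = σ.mem ∧ Keeps 12 σ (run prepareGrid σ) := by
  have hk : Keeps 12 σ (run prepareGrid σ) := keeps_run (by simp [prepareGrid, Instr.WritesFrom]) σ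
  -- The machine's floor is the integer one; it agrees with `Nat.floor` since 256/ε is non-negative.
  have hN' : (⌊256 / ε⌋ : ℝ) + 1 = N := by
    rw [hN, ← natCast_floor_eq_intCast_floor (by positivity)]; push_cast; rfl
  have hd : √(dist q z ^ 2) = dist q z := Real.sqrt_sq dist_nonneg
  refine ⟨⟨?_, ?_, ?_, ?_⟩, ?_, ?_, ?_, ?_, hk⟩ <;> simp only [prepareGrid, run_cons, run_nil,
      act_sqrt, act_div, act_floor, act_add, act_mul, act_const] <;>
    simp [hσ.r1, hσ.r2, hσ.r3, hσ.r5, hσ.r6, hq.r9, hN', hd] <;> ring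

/-- Run `A` on one point from every non-empty cell of the grid, and label every point as the
representative of its cell. -/
def roundAndSolve (A : Program) : Block := (straight prepareGrid).seq (buildTable.seq
  ((straight [.store 19 21]).seq ((embedded A).seq (writeLabels
    (straight (locate ++ [.add 31 31 19, .sub 31 31 1, .load 31 31]))))))

lemma le_maxTime (T : ℕ → ℕ) {k N : ℕ} (h2 : 2 ≤ k) (hk : k ≤ N) : T k ≤ maxTime T N :=
  Finset.le_sup (f := T) (Finset.mem_Icc.2 ⟨h2, hk⟩)

lemma maxTime_mono (T : ℕ → ℕ) {N N' : ℕ} (h : N ≤ N') : maxTime T N ≤ maxTime T N' :=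
  Finset.sup_mono (Finset.Icc_subset_Icc_right h)

/-- Points of one cell are at most 2R/N apart, which yields the additive error. The called program
gets at least two points, because the first point and a farthest one never share a cell, and at most
one point per cell. -/
lemma runs_roundAndSolve {A : Program} {T : ℕ → ℕ} (hA : IsExactAlgorithm A T) {n : ℕ}
    {p : Fin n → Plane} (hinj : Function.Injective p) {ε : ℝ} (hε : 0 < ε) (hε' : ε < 128)
    {i₀ j₀ : Fin n} {σ₀ : Store} (hσ : Setup n ε (p i₀) σ₀) (hq : Farthest (p i₀) (p j₀) σ₀)
    (hne : p j₀ ≠ p i₀) (hfar : ∀ i, dist (p i) (p i₀) ≤ dist (p j₀) (p i₀))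
    (hm : ∀ i : Fin n, HasPoint σ₀.mem i (p i)) (hz : ∀ c, 2 * n + 2 ≤ c → σ₀.mem c = 0)
    (hreg : ∀ r, σ₀.reg (r + 32) = 0) {N : ℕ} (hN : N = ⌊256 / ε⌋₊ + 1) :
    (roundAndSolve A).Runs
      (17 + (n * (15 + (8 + 1) + 2) + 1 + (1 + (6 * maxTime T ((2 * N + 1) ^ 2)
        + (1 + (n * (18 + 2 + 2) + 1))))))
      (fun σ => ∃ c : Fin n → Bool, Outputs σ.mem c ∧ IsBipartition c ∧
        ∀ c', cost p c ≤ cost p c' + 4 * Real.pi * (2 * dist (p j₀) (p i₀) / N)) σ₀ := by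
  set R := dist (p j₀) (p i₀) with hR
  have hR0 : 0 < R := dist_pos.2 hne
  have hN0 : 0 < (N : ℝ) := by rw [hN]; positivity
  -- This is where ε < 128 is needed: it makes 2R/N smaller than R.
  have hN3 : 2 < (N : ℝ) := by
    have h1 : (256 : ℝ) / ε > 2 := by rw [gt_iff_lt, lt_div_iff₀ hε]; linarith
    have h2 := Nat.lt_floor_add_one (256 / ε)
    rw [hN]; push_cast; linarith
  have hS : 0 ≤ N / R := by positivity
  have hp : ∀ i, dist (p i) (p i₀) * (N / R) ≤ N := fun i => by
    rw [mul_div_assoc', div_le_iff₀ hR0, mul_comm]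
    exact mul_le_mul_of_nonneg_left (hfar i) hN0.le
  obtain ⟨g1, g2, g3, g4, g5, g6⟩ := run_prepareGrid hσ hq hε hN
  refine Block.Runs.seq (runs_straight (by simp [prepareGrid, Instr.IsPlain]) ?_)
  set σ₁ := run prepareGrid σ₀
  have hσ₁ := hσ.of_keeps g6 (by norm_num)
  refine Block.Runs.seq ((runs_buildTable hσ₁ g1 hS hp (fun i => by rw [g5]; exact hm i)
    (by rw [g5]; exact hz) g2 g3 g4 i₀.pos).mono le_rfl ?_)
  rintro σ₂ ⟨k2, k, f, hk21, hT⟩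
  have hσ₂ := hσ₁.of_keeps k2 (by norm_num)
  have hG₂ := g1.of_keeps k2 le_rfl
  set B := 2 * n + 2 + (2 * N + 1) ^ 2 with hB
  set key : Fin n → ℕ := fun i => cell (p i₀) N (N / R) (p i) with hkey
  have hkeyB : ∀ i, 2 * n + 2 + key i < B := fun i => by
    have := cell_lt hS (hp i); simp only [hkey, hB]; omega
  have hclose : ∀ i j, key i = key j → dist (p i) (p j) ≤ 2 * R / N := fun i j hij => by
    have := dist_mul_le_of_cell_eq hS (hp i) (hp j) hij
    rw [mul_div_assoc', div_le_iff₀ hR0] at this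
    rwa [le_div_iff₀ hN0]
  choose g hgk hg using fun i : Fin n => hT.found i i.2
  have hk2 : 2 ≤ k := by
    by_contra hcon
    have e1 := hgk i₀
    have e2 := hgk j₀
    have e3 : g j₀ = g i₀ := by omega
    have := hclose j₀ i₀ (by rw [← hg j₀, ← hg i₀, e3])
    rw [← hR, le_div_iff₀ hN0] at this
    nlinarith
  let f' : Fin k → Fin n := fun a => f a
  let g' : Fin n → Fin k := fun i => ⟨g i, hgk i⟩
  have hf' : Function.Injective f' := fun a b hab =>
    Fin.ext (hT.key_injective a.2 b.2 (congrArg key hab))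
  have hkN : k ≤ (2 * N + 1) ^ 2 := by
    have : Function.Injective fun a : Fin k =>
        (⟨key (f' a), cell_lt hS (hp _)⟩ : Fin ((2 * N + 1) ^ 2)) := fun a b hab =>
      Fin.ext (hT.key_injective a.2 b.2 (Fin.mk.inj hab))
    simpa using Fintype.card_le_of_injective _ this
  obtain ⟨m, c, hhalt, hout, hopt⟩ := hA k (p ∘ f') hk2 (hinj.comp hf')
  refine Block.Runs.seq (runs_straight (by simp [Instr.IsPlain]) ?_)
  simp only [run_cons, run_nil, act_store, hG₂.r19, hk21, Nat.floor_natCast]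
  rw [← hB]
  set σ₃ : Store := ⟨σ₂.reg, Function.update σ₂.mem B k⟩
  -- Registers from 32 on and the memory behind the representatives are still zero, so the called
  -- program sees exactly its initial configuration.
  have hsim : Simulates B σ₃ ⟨fun _ => 0, fun i => ((k : ℝ) :: coords (p ∘ f')).getD i 0⟩ σ₃ :=
    { two := hσ₂.r2
      reg_base := hG₂.r19
      reg := fun r => (k2 _ (Or.inr (by omega))).trans ((g6 _ (Or.inr (by omega))).trans (hreg r))
      mem := eq_getD_cons_coords (m := fun j => σ₃.mem (B + j)) (by simp [σ₃])
        (fun a => by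
          have := hT.point a a.2
          simp only [σ₃, Function.comp_apply, f']
          rw [Function.update_of_ne (by omega), Function.update_of_ne (by omega),
            show B + (2 * a.val + 1) = B + 1 + 2 * a by ring,
            show B + (2 * a.val + 2) = B + 2 + 2 * a by ring]
          exact this)
        (fun j hj => by
          simp only [σ₃]
          rw [Function.update_of_ne (by omega)]
          exact hT.rest _ (by omega))
      outer_reg := fun _ _ _ => rfl
      outer_mem := fun _ _ => rfl }
  refine Block.Runs.seq ((runs_embedded hhalt hsim).mono
    (Nat.mul_le_mul_left 6 (le_maxTime T hk2 hkN)) ?_)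
  rintro σ₄ ⟨hm4, hr4, ho4⟩
  have hσ₄ : Setup n ε (p i₀) σ₄ := hσ₂.of_eq fun r hr => hr4 r (by omega) (by omega)
  have hG₄ : Grid n N (N / R) σ₄ := hG₂.of_eq fun r hr => hr4 r (by omega) (by omega)
  have hlow : ∀ j, j < B → σ₄.mem j = σ₂.mem j := fun j hj =>
    (ho4 j hj).trans (Function.update_of_ne hj.ne _ _)
  have hcost := hopt.cost_comp_le hk2 (g := g') (δ := 2 * R / N) (by positivity)
    fun i => hclose i (f (g i)) (hg i).symm
  refine (runs_writeLabels (lab := fun i => if c (g' i) = true then 1 else 0) hσ₄.r1 hσ₄.r5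
    ?_).mono le_rfl fun σ h => ⟨c ∘ g', h, fun b => ?_, hcost⟩
  · intro i σ hk hi hge
    have hin := i.2
    have hpt : HasPoint σ.mem i (p i) := by
      have hmi := hm i
      rw [← g5] at hmi
      exact ⟨(hge _ (by omega)).trans ((hlow _ (by omega)).trans
          ((hT.input _ (by omega)).trans hmi.1)),
        (hge _ (by omega)).trans ((hlow _ (by omega)).trans
          ((hT.input _ (by omega)).trans hmi.2))⟩
    have hσσ := hσ₄.of_keeps hk (by norm_num)
    have hGσ := hG₄.of_keeps hk (by norm_num)
    obtain ⟨-, -, -, e4, e5, e6⟩ := run_locate hσσ hGσ hS (hp i) hi hpt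
    refine runs_straight (by simp [locate, fetch, Instr.IsPlain]) ?_
    rw [run_append]
    set τ := run locate σ
    have hτ := hσσ.of_keeps e6 (by norm_num)
    have hGτ := hGσ.of_keeps e6 (by norm_num)
    have e31 : τ.reg 31 = (g i : ℝ) + 1 := by
      rw [e4, hge _ (by omega), hlow _ (hkeyB i), ← hT.entry (g i) (hgk i), hg i]
    -- Subtracting 1 undoes the shift of the table entries.
    have eaddr : ⌊(g i : ℝ) + 1 + (B : ℕ) - 1⌋₊ = B + g i := by
      rw [show (g i : ℝ) + 1 + (B : ℕ) - 1 = ((B + g i : ℕ) : ℝ) by push_cast; ring,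
        Nat.floor_natCast]
    have e19 : τ.reg 19 = (B : ℕ) := hGτ.r19
    refine ⟨e6.trans (keeps_run (by simp [Instr.WritesFrom]) τ) le_rfl, e5, ?_⟩
    simp only [run_cons, run_nil, act_add, act_sub, act_load, Function.update_self, e31, e19,
      Function.update_of_ne (show (1 : ℕ) ≠ 31 by norm_num), hτ.r1, eaddr, e5]
    rw [hge _ (by omega), hm4]
    exact hout (g' i)
  -- Every representative represents itself, so both labels survive the extension.
  · obtain ⟨a, ha⟩ := hopt.1 b
    refine ⟨f' a, ?_⟩
    have : g' (f' a) = a := Fin.ext (hT.key_injective (hgk _) a.2 (hg (f' a)))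
    rw [Function.comp_apply, this, ha]

/-! ### The approximation scheme -/

/-- The approximation scheme that calls the exact algorithm `A`. -/
def approximationScheme (A : Program) : Block := prepare.seq (findFarthest.seq (detectSpread.seq
  (ifLe 12 0 separateClose (roundAndSolve A))))

/-- The comparison is with all labellings, constant ones included, since the lower bounds on the
cost hold for these too. -/
lemma runs_approximationScheme {A : Program} {T : ℕ → ℕ} (hA : IsExactAlgorithm A T) {n : ℕ}
    (hn : 2 ≤ n) {p : Fin n → Plane} (hinj : Function.Injective p) {ε : ℝ} (hε : 0 < ε) {N : ℕ}
    (hN : N = ⌊256 / ε⌋₊ + 1) {X : ℕ} (hX : ε < 128 → maxTime T ((2 * N + 1) ^ 2) ≤ X) :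
    (approximationScheme A).Runs (200 * n + 6 * X) (fun σ => ∃ c : Fin n → Bool,
      Outputs σ.mem c ∧ IsBipartition c ∧ ∀ c', cost p c ≤ (1 + ε) * cost p c')
      ⟨fun _ => 0, fun j => ((n : ℝ) :: ε :: coords p).getD j 0⟩ := by
  classical
  have hpi := Real.pi_lt_four
  have hpi0 := Real.pi_pos
  let i₀ : Fin n := ⟨0, by omega⟩
  refine Block.Runs.mono (t := 9 + (n * (10 + (3 + 2 + 1) + 2) + 1 +
    (2 + (n * (17 + (5 + 1) + 2) + 1 + 3) + ((48 * n + 22 + 6 * X) + 2)))) ?_ (by omega)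
    fun _ h => h
  refine Block.Runs.seq ((runs_prepare p ε i₀ rfl).mono le_rfl ?_)
  rintro σ₁ ⟨hσ₁, hr1, hm1⟩
  have hpt : ∀ i : Fin n, HasPoint σ₁.mem i (p i) := fun i => by
    rw [hm1]; exact hasPoint_input p _ _ i
  refine Block.Runs.seq ((runs_findFarthest hσ₁ (hr1 9 (by norm_num) (by norm_num))
    (hr1 22 (by norm_num) (by norm_num)) hpt ⟨⟨1, by omega⟩, fun h => by
      have := congrArg Fin.val (hinj h); simp [i₀] at this⟩).mono le_rfl ?_)
  rintro σ₂ ⟨k2, hm2, j₀, hne, hq, hfar⟩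
  have hσ₂ := hσ₁.of_keeps k2 le_rfl
  have hpt₂ : ∀ i : Fin n, HasPoint σ₂.mem i (p i) := by rw [hm2]; exact hpt
  refine Block.Runs.seq ((runs_detectSpread hσ₂ hq hpt₂).mono le_rfl ?_)
  rintro σ₃ ⟨k3, hm3, hspread⟩
  have hσ₃ := hσ₂.of_keeps k3 (by norm_num)
  have hq₃ := hq.of_keeps k3 le_rfl
  have hpt₃ : ∀ i : Fin n, HasPoint σ₃.mem i (p i) := by rw [hm3]; exact hpt₂
  have hR0 : 0 < dist (p j₀) (p i₀) := dist_pos.2 hne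
  have hdist : dist (p i₀) (p j₀) = dist (p j₀) (p i₀) := dist_comm _ _
  have hcost0 : ∀ c' : Fin n → Bool, 0 ≤ cost p c' := fun c' =>
    add_nonneg (per_nonneg _) (per_nonneg _)
  refine runs_ifLe (fun hc => ?_) (fun hc => ?_)
  · rw [hσ₃.r0] at hc
    refine (runs_separateClose hσ₃ hq₃ hpt₃).mono (by omega)
      fun σ hout => ⟨_, hout, ?_, fun c' => ?_⟩
    · rintro (_ | _)
      · refine ⟨j₀, ?_⟩
        simp only [decide_eq_false_iff_not, not_le]; linarith
      · refine ⟨i₀, ?_⟩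
        simp only [decide_eq_true_eq, dist_self]; positivity
    · rcases hspread with ⟨-, h⟩ | ⟨h, -⟩
      swap
      · rw [h] at hc; norm_num at hc
      by_cases hcl : ∀ i, dist (p i) (p i₀) ≤ dist (p j₀) (p i₀) / 16 ∨
          dist (p i) (p j₀) ≤ dist (p j₀) (p i₀) / 16
      · have := cost_le_of_clustered (p := p) (c' := c') hdist
          (c := fun i => decide (dist (p i) (p i₀) ≤ dist (p j₀) (p i₀) / 16))
          (fun i hi => by simpa using hi)
          (fun i hi => (hcl i).resolve_left (by simpa using hi))
          (by simp only [decide_eq_true_eq, dist_self]; positivity)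
          (by simp only [decide_eq_false_iff_not, not_le]; linarith)
        nlinarith [hcost0 c']
      -- Here ε ≥ 128: any bipartition costs at most 4πR ≤ 16R = 128 · R/8, and the optimum is at
      -- least R/8.
      · have hε' := h.resolve_right hcl
        push Not at hcl
        obtain ⟨i, h1, h2⟩ := hcl
        have e1 := le_cost_of_spread (p := p) (c := c') hdist h1.le h2.le
        have e2 := cost_le_of_dist_le (p := p)
          (c := fun i => decide (dist (p i) (p i₀) ≤ dist (p j₀) (p i₀) / 16)) hR0.le hfar
        nlinarith
  · rw [hσ₃.r0] at hc
    rcases hspread with ⟨h, -⟩ | ⟨-, hε', i, h1, h2⟩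
    · rw [h] at hc; exact absurd hc (lt_irrefl _)
    have hX' := hX hε'
    refine (runs_roundAndSolve hA hinj hε hε' hσ₃ hq₃ hne hfar hpt₃ (fun j hj => ?_) (fun r => ?_)
      hN).mono (by omega) ?_
    · rw [hm3, hm2, hm1]
      exact List.getD_eq_default _ _ (by simp only [List.length_cons, length_coords]; omega)
    · rw [k3 _ (Or.inr (by omega)), k2 _ (Or.inr (by omega))]
      exact hr1 _ (by omega) (by omega)
    · rintro σ ⟨c, hout, hbip, hc⟩
      refine ⟨c, hout, hbip, fun c' => (hc c').trans ?_⟩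
      have e1 := le_cost_of_spread (p := p) (c := c') hdist h1 h2
      have hN0 : 0 < (N : ℝ) := by rw [hN]; positivity
      have hNε : 256 ≤ ε * N := by
        have := Nat.lt_floor_add_one (256 / ε)
        rw [div_lt_iff₀ hε] at this
        rw [hN]; push_cast; linarith
      -- From π < 4 and R ≤ 8 · cost one gets 8πR ≤ 256 · cost; this determines the constant 256 in
      -- N.
      have e2 : 4 * Real.pi * (2 * dist (p j₀) (p i₀) / N) ≤ ε * cost p c' := by
        rw [mul_div_assoc', div_le_iff₀ hN0]
        calc 4 * Real.pi * (2 * dist (p j₀) (p i₀)) ≤ 256 * cost p c' := by nlinarith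
          _ ≤ ε * N * cost p c' := mul_le_mul_of_nonneg_right hNε (hcost0 c')
          _ = ε * cost p c' * N := by ring
      linarith

lemma isApproximationScheme_approximationScheme {A : Program} {T : ℕ → ℕ}
    (hA : IsExactAlgorithm A T) : IsApproximationScheme ((approximationScheme A).code 0)
      fun n ε => 10 ^ 6 * ((n : ℝ) + (maxTime T ⌊10 ^ 6 / ε ^ 2⌋₊ : ℝ)) := by
  intro n p ε hn hinj hε
  -- For ε < 128 the side count is at most 512/ε + 3 ≤ 512/ε + 384/ε, below 1000/ε.
  have hfloor : ε < 128 → (2 * (⌊256 / ε⌋₊ + 1) + 1) ^ 2 ≤ ⌊10 ^ 6 / ε ^ 2⌋₊ := fun hε' => by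
    refine Nat.le_floor ?_
    have h1 := Nat.floor_le (show 0 ≤ 256 / ε by positivity)
    have h2 : (3 : ℝ) ≤ 384 / ε := by rw [le_div_iff₀ hε]; linarith
    have h3 : (10 : ℝ) ^ 6 / ε ^ 2 = (1000 / ε) ^ 2 := by rw [div_pow]; norm_num
    have h4 : (1000 : ℝ) / ε = 2 * (256 / ε) + 384 / ε + 104 / ε := by ring
    have h5 : 0 ≤ 104 / ε := by positivity
    rw [h3]
    push_cast
    gcongr
    linarith
  obtain ⟨t, ht, σ, ⟨c, hout, hbip, hc⟩, hhalt⟩ := (runs_approximationScheme hA hn hinj hε rfl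
    (X := maxTime T ⌊10 ^ 6 / ε ^ 2⌋₊) fun hε' =>
      maxTime_mono T (hfloor hε')).haltsWithin
  refine ⟨t, σ.mem, c, ?_, hhalt, hout, hbip, fun cOpt _ => hc cOpt⟩
  have h1 : (t : ℝ) ≤ 200 * n + 6 * (maxTime T ⌊10 ^ 6 / ε ^ 2⌋₊ : ℝ) := by exact_mod_cast ht
  have h2 : (0 : ℝ) ≤ (maxTime T ⌊10 ^ 6 / ε ^ 2⌋₊ : ℝ) := Nat.cast_nonneg _
  have h3 : (0 : ℝ) ≤ n := Nat.cast_nonneg _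
  linarith

/-! ### Consequences for particular growth of the running time -/

lemma IsApproximationScheme.mono {B : Program} {bound bound' : ℕ → ℝ → ℝ}
    (h : IsApproximationScheme B bound)
    (hle : ∀ (n : ℕ) (ε : ℝ), 2 ≤ n → 0 < ε → bound n ε ≤ bound' n ε) :
    IsApproximationScheme B bound' := fun n p ε hn hinj hε => by
  obtain ⟨t, m, c, ht, hrest⟩ := h n p ε hn hinj hε
  exact ⟨t, m, c, ht.trans (hle n ε hn hε), hrest⟩

/-- Since 10⁶ ≤ 2²⁰, twenty doublings of ⌈1/ε²⌉ reach every relevant instance size. -/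
lemma maxTime_le_of_doubling {T : ℕ → ℕ} {D : ℕ} (hT : Monotone T)
    (hD : ∀ k : ℕ, 1 ≤ k → T (2 * k) ≤ D * T k) {ε : ℝ} (hε : 0 < ε) :
    maxTime T ⌊10 ^ 6 / ε ^ 2⌋₊ ≤ D ^ 20 * T ⌈1 / ε ^ 2⌉₊ := by
  have hpow : ∀ j k : ℕ, 1 ≤ k → T (2 ^ j * k) ≤ D ^ j * T k := fun j k hk => by
    induction j with
    | zero => simp
    | succ j ih =>
      have h1 : 1 ≤ 2 ^ j * k := Nat.mul_pos (by positivity) hk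
      calc T (2 ^ (j + 1) * k) = T (2 * (2 ^ j * k)) := by ring_nf
        _ ≤ D * T (2 ^ j * k) := hD _ h1
        _ ≤ D * (D ^ j * T k) := Nat.mul_le_mul_left D ih
        _ = D ^ (j + 1) * T k := by ring
  refine Finset.sup_le fun k hk => ?_
  refine (hT ((Finset.mem_Icc.1 hk).2.trans (?_ : _ ≤ 2 ^ 20 * ⌈1 / ε ^ 2⌉₊))).trans
    (hpow 20 _ (Nat.ceil_pos.2 (by positivity)))
  apply Nat.floor_le_of_le
  have h1 := Nat.le_ceil (1 / ε ^ 2)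
  have h2 : (0 : ℝ) ≤ 1 / ε ^ 2 := by positivity
  have h3 : (10 : ℝ) ^ 6 / ε ^ 2 = 10 ^ 6 * (1 / ε ^ 2) := by ring
  push_cast
  rw [h3]
  linarith

/-- Near ε = 1 the factor log(1/ε) vanishes and cannot bound anything, so a constant is added. It
covers ε > 1/2, where k ≤ 4 · 10⁶; for ε ≤ 1/2 the logarithmic term suffices. -/
lemma maxTime_le_of_log {T : ℕ → ℕ} {a : ℝ}
    (hT : ∀ k : ℕ, 2 ≤ k → (T k : ℝ) ≤ a * (k : ℝ) * Real.log (k : ℝ) ^ 4) {ε : ℝ} (hε : 0 < ε) :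
    (maxTime T ⌊10 ^ 6 / ε ^ 2⌋₊ : ℝ) ≤ |a| * (4 * 10 ^ 6) ^ 5
      + |a| * (10 ^ 6 * 22 ^ 4) * (1 / ε ^ 2 * Real.log (1 / ε) ^ 4) := by
  have hlog0 : 0 ≤ Real.log (1 / ε) ^ 4 := by
    rw [show Real.log (1 / ε) ^ 4 = (Real.log (1 / ε) ^ 2) ^ 2 by ring]; positivity
  have ha := abs_nonneg a
  obtain ⟨k, hk, hmax⟩ | hemp : (∃ k ∈ Finset.Icc 2 ⌊10 ^ 6 / ε ^ 2⌋₊,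
      maxTime T ⌊10 ^ 6 / ε ^ 2⌋₊ = T k) ∨ maxTime T ⌊10 ^ 6 / ε ^ 2⌋₊ = 0 := by
    rcases (Finset.Icc 2 ⌊10 ^ 6 / ε ^ 2⌋₊).eq_empty_or_nonempty with h | h
    · right; rw [maxTime, h]; rfl
    · left; exact Finset.exists_mem_eq_sup _ h T
  swap
  · rw [hemp, Nat.cast_zero]; positivity
  rw [hmax]
  obtain ⟨hk2, hkle⟩ := Finset.mem_Icc.1 hk
  have hkε : (k : ℝ) ≤ 10 ^ 6 / ε ^ 2 := (Nat.le_floor_iff (by positivity)).1 hkle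
  have hk1 : (1 : ℝ) ≤ k := by exact_mod_cast (by omega : 1 ≤ k)
  have hlk : 0 ≤ Real.log k := Real.log_nonneg hk1
  have h1 : (T k : ℝ) ≤ |a| * k * Real.log k ^ 4 := (hT k hk2).trans (by
    gcongr; exact le_abs_self a)
  refine h1.trans ?_
  rcases le_or_gt ε (1 / 2) with hε' | hε'
  · have hl : Real.log 2 ≤ Real.log (1 / ε) := Real.log_le_log (by norm_num) (by
      rw [le_div_iff₀ hε]; linarith)
    have hl2 : 0 < Real.log 2 := Real.log_pos (by norm_num)
    -- From k ≤ 2²⁰/ε² follows log k ≤ 20 log 2 + 2 log(1/ε), and log 2 ≤ log(1/ε).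
    have h2 : Real.log k ≤ 22 * Real.log (1 / ε) := by
      have e : (k : ℝ) ≤ 2 ^ 20 * (1 / ε) ^ 2 := hkε.trans (by
        rw [div_pow, one_pow, mul_one_div]; gcongr; norm_num)
      have := Real.log_le_log (by linarith) e
      rw [Real.log_mul (by positivity) (by positivity), Real.log_pow, Real.log_pow] at this
      push_cast at this
      linarith
    have h3 : |a| * k * Real.log k ^ 4
        ≤ |a| * (10 ^ 6 / ε ^ 2) * (22 * Real.log (1 / ε)) ^ 4 := by gcongr
    have h4 : |a| * (10 ^ 6 / ε ^ 2) * (22 * Real.log (1 / ε)) ^ 4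
        = |a| * (10 ^ 6 * 22 ^ 4) * (1 / ε ^ 2 * Real.log (1 / ε) ^ 4) := by ring
    have h5 : 0 ≤ |a| * (4 * 10 ^ 6 : ℝ) ^ 5 := by positivity
    linarith
  · have h2 : (k : ℝ) ≤ 4 * 10 ^ 6 := hkε.trans (by
      rw [div_le_iff₀ (by positivity)]; nlinarith)
    have h3 : Real.log k ≤ 4 * 10 ^ 6 := (Real.log_le_self (by linarith)).trans h2
    have h4 : |a| * k * Real.log k ^ 4 ≤ |a| * (4 * 10 ^ 6) * (4 * 10 ^ 6) ^ 4 := by gcongr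
    have h5 : 0 ≤ |a| * (10 ^ 6 * 22 ^ 4) * (1 / ε ^ 2 * Real.log (1 / ε) ^ 4) := by positivity
    have h6 : |a| * (4 * 10 ^ 6 : ℝ) * (4 * 10 ^ 6) ^ 4 = |a| * (4 * 10 ^ 6) ^ 5 := by ring
    linarith

end PerimeterSum
end
open PerimeterSum in
theorem theorem3 :
    ∃ (C : ℝ) (K : ℕ → ℝ) (L : ℝ → ℝ), 0 < C ∧
      ∀ (A : Program) (T : ℕ → ℕ), IsExactAlgorithm A T →
        ∃ B : Program,
          IsApproximationScheme B
            (fun n ε => C * ((n : ℝ) + (maxTime T ⌊C / ε ^ 2⌋₊ : ℝ))) ∧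
          (∀ D : ℕ, Monotone T → (∀ k : ℕ, 1 ≤ k → T (2 * k) ≤ D * T k) →
            IsApproximationScheme B
              (fun n ε => K D * ((n : ℝ) + (T ⌈1 / ε ^ 2⌉₊ : ℝ)))) ∧
          (∀ a : ℝ, (∀ k : ℕ, 2 ≤ k → (T k : ℝ) ≤ a * (k : ℝ) * Real.log (k : ℝ) ^ 4) →
            IsApproximationScheme B
              (fun n ε => L a * ((n : ℝ) + 1 / ε ^ 2 * Real.log (1 / ε) ^ 4))) := by
  refine ⟨10 ^ 6, fun D => 10 ^ 6 * (1 + (D : ℝ) ^ 20),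
    fun a => 10 ^ 6 * (1 + |a| * (4 * 10 ^ 6) ^ 5 + |a| * (10 ^ 6 * 22 ^ 4)), by norm_num,
    fun A T hA => ⟨(approximationScheme A).code 0, ?_, ?_, ?_⟩⟩
  · exact isApproximationScheme_approximationScheme hA
  · intro D hT hD
    refine (isApproximationScheme_approximationScheme hA).mono fun n ε _ hε => ?_
    have h1 : (maxTime T ⌊10 ^ 6 / ε ^ 2⌋₊ : ℝ) ≤ (D : ℝ) ^ 20 * T ⌈1 / ε ^ 2⌉₊ := by
      exact_mod_cast maxTime_le_of_doubling hT hD hε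
    have h2 : 0 ≤ (D : ℝ) ^ 20 * n := by positivity
    have h3 : (0 : ℝ) ≤ T ⌈1 / ε ^ 2⌉₊ := Nat.cast_nonneg _
    rw [mul_assoc]
    gcongr
    linarith
  · intro a ha
    refine (isApproximationScheme_approximationScheme hA).mono fun n ε hn hε => ?_
    have h1 := maxTime_le_of_log ha hε
    -- The additive constant of the logarithmic bound is absorbed by the term n ≥ 1.
    have hn1 : (1 : ℝ) ≤ n := by exact_mod_cast (by omega : 1 ≤ n)
    have hY : 0 ≤ 1 / ε ^ 2 * Real.log (1 / ε) ^ 4 := by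
      rw [show Real.log (1 / ε) ^ 4 = (Real.log (1 / ε) ^ 2) ^ 2 by ring]; positivity
    have hU : 0 ≤ |a| * (4 * 10 ^ 6 : ℝ) ^ 5 := by positivity
    have hV : 0 ≤ |a| * (10 ^ 6 * 22 ^ 4 : ℝ) := by positivity
    rw [mul_assoc]
    generalize 1 / ε ^ 2 * Real.log (1 / ε) ^ 4 = Y at *
    generalize |a| * (4 * 10 ^ 6 : ℝ) ^ 5 = U at *
    generalize |a| * (10 ^ 6 * 22 ^ 4 : ℝ) = V at *
    gcongr
    nlinarith [mul_nonneg hU hY, mul_nonneg hU (sub_nonneg.2 hn1), mul_nonneg hV (sub_nonneg.2 hn1)]
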